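/- Let $M>0$, $l>0$, $a\ge -1$, put $f(r)=1-\frac{2M}{r}+\frac{r^2}{l^2}$ and let $r_+>0$ be the positive zero of $f$. Consider the Schwarzschild-AdS metric of mass $M$ and cosmological constant $-3/l^2$ in ingoing Eddington–Finkelstein coordinates $(v,r,\theta,\varphi)$, $$g=-f(r)\,dv^2+2\,dv\,dr+r^2(d\theta^2+\sin^2\theta\,d\varphi^2);$$ equivalently $g=-f\,dU\,dv+r^2(d\theta^2+\sin^2\theta\,d\varphi^2)$ with $r_U=-r_v=-\frac12 f$ in the double null Eddington–Finkelstein coordinates $(U,v)$. For a function $\psi=\psi(v,r)$ define the energy flux through the part of the ingoing null cone of constant $v$ outside the horizon, $$\mathbb F[\psi](v)=\int_{r_+}^{\infty}\Big(r^4(\partial_r\psi)^2+r^2\psi^2\Big)(v,r)\,dr\in[0,\infty].$$ Then there are constants $B,c>0$ depending only on $M$, $l$ and $a$ with the following property. Let $v_0\in\mathbb R$ and let $\psi=\psi(v,r)$ be a spherically symmetric solution of $$\Box_g\psi-\frac{2a}{l^2}\psi=0$$ on the exterior region $\{v\ge v_0,\ r\ge r_+\}$ to the future of the cone $v=v_0$,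 which is $C^2$ up to and including the event horizon $r=r_+$ and the initial cone, and which satisfies the Dirichlet boundary condition at infinity in the sense that $\mathbb F[\psi](v)$ and $\mathbb F[\partial_v\psi](v)$ are finite and bounded on every interval $[v_0,v_1]$ (where $\partial_v$ is taken at fixed $r$, that is, along the stationary Killing field). Then for all $v\ge v_0$ and all $r\ge r_+$ $$\mathbb F[\psi](v)\le B\,e^{-c(v-v_0)}\,\mathbb F[\psi](v_0),\qquad |\psi(v,r)|\le B\,e^{-c(v-v_0)}\,r^{-3/2}\sqrt{\mathbb F[\psi](v_0)} .$$ -/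

import Mathlib

open MeasureTheory Set

noncomputable section

namespace SchwarzschildAdS

/-- The function `1 - 2M/r + r²/l²` (written `1 - μ`) of the Schwarzschild-AdS metric. -/
def lapse (M l r : ℝ) : ℝ := 1 - 2 * M / r + r ^ 2 / l ^ 2

/-- The Schwarzschild-AdS metric in ingoing Eddington-Finkelstein coordinates
`x = (v, r, θ, φ)`, namely `g = -(1-μ) dv² + 2 dv dr + r² (dθ² + sin² θ dφ²)`.
With `U` defined by `dU = dv - 2 dr / (1-μ)` it is `-(1-μ) dU dv + r² (dθ² + sin² θ dφ²)`, so that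
`r_U = -r_v = -(1-μ)/2` in the double null coordinates `(U, v)`, with the same `v`. The coordinates
`(v, r)` stay regular at the future event horizon. -/
def metric (M l : ℝ) (x : Fin 4 → ℝ) : Matrix (Fin 4) (Fin 4) ℝ :=
  !![-lapse M l (x 1), 1, 0, 0;
     1, 0, 0, 0;
     0, 0, (x 1) ^ 2, 0;
     0, 0, 0, (x 1) ^ 2 * Real.sin (x 2) ^ 2]

/-- The partial derivative in the `μ`-th coordinate. -/
def coordDeriv (μ : Fin 4) (h : (Fin 4 → ℝ) → ℝ) (x : Fin 4 → ℝ) : ℝ :=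
  deriv (fun s => h (Function.update x μ s)) (x μ)

/-- The wave operator `□_g ψ = |det g|^(-1/2) ∂_μ (|det g|^(1/2) g^{μν} ∂_ν ψ)` of a
Lorentzian metric `g` given in a coordinate chart. -/
def waveOp (g : (Fin 4 → ℝ) → Matrix (Fin 4) (Fin 4) ℝ) (ψ : (Fin 4 → ℝ) → ℝ)
    (x : Fin 4 → ℝ) : ℝ :=
  (Real.sqrt |(g x).det|)⁻¹ *
    ∑ μ, coordDeriv μ
      (fun y => Real.sqrt |(g y).det| * ∑ ν, (g y)⁻¹ μ ν * coordDeriv ν ψ y) x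

/-- The spherically symmetric scalar field on spacetime given by a function of `(v, r)`. -/
def symmField (Ψ : ℝ → ℝ → ℝ) (x : Fin 4 → ℝ) : ℝ := Ψ (x 0) (x 1)

/-- The (nondegenerate, `r`-weighted) energy flux of `Ψ` through the part of the ingoing null cone
`{v = const}` outside the horizon `r = rp`: `∫_{rp}^∞ (r⁴ (∂_r Ψ)² + r² Ψ²) dr`, with `∂_r` taken at
fixed `v`. As `∂_r = (1 / r_u) ∂_u` along the cone, in any null coordinate `u` this is
`∫ (r⁴ (∂_u Ψ)² / (-r_u) + r² Ψ² (-r_u)) du`. -/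
def flux (rp : ℝ) (Ψ : ℝ → ℝ → ℝ) (v : ℝ) : ENNReal :=
  ∫⁻ r in Ioi rp, ENNReal.ofReal (r ^ 4 * (deriv (fun s => Ψ v s) r) ^ 2 + r ^ 2 * (Ψ v r) ^ 2)

/-- The derivative along the stationary Killing field `∂_t`, which is `∂_v` at fixed `r`
(one-sided on the initial cone `v = v0`). -/
def killingDeriv (v0 : ℝ) (Ψ : ℝ → ℝ → ℝ) (v r : ℝ) : ℝ :=
  derivWithin (fun w => Ψ w r) (Ici v0) v

/-- Spherically symmetric solutions of `□_g ψ - (2a/l²) ψ = 0` on the exterior region `r ≥ rp` to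
the future of the ingoing null cone `v = v0`: twice continuously differentiable up to and including
the future event horizon and the initial cone, with the Dirichlet condition at infinity expressed by
the finiteness, locally uniformly in `v`, of the weighted energies of `ψ` and of `∂_t ψ`. -/
structure IsSolution (M l a rp v0 : ℝ) (Ψ : ℝ → ℝ → ℝ) : Prop where
  contDiffOn : ContDiffOn ℝ 2 (fun p : ℝ × ℝ => Ψ p.1 p.2) (Ici v0 ×ˢ Ici rp)
  wave_eq : ∀ x : Fin 4 → ℝ, v0 < x 0 → rp < x 1 → 0 < x 2 → x 2 < Real.pi →
    waveOp (metric M l) (symmField Ψ) x - 2 * a / l ^ 2 * symmField Ψ x = 0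
  flux_bounded : ∀ v1 : ℝ, ∃ C : NNReal, ∀ v ∈ Icc v0 v1, flux rp Ψ v ≤ C
  flux_killingDeriv_bounded :
    ∀ v1 : ℝ, ∃ C : NNReal, ∀ v ∈ Icc v0 v1, flux rp (killingDeriv v0 Ψ) v ≤ C

end SchwarzschildAdS

end

/-!
For a spherically symmetric field, `r ψ` satisfies a wave equation in `(v, r)` whose zeroth order
coefficient `2M/r³ + 2(1+a)/l²` is nonnegative exactly because `a ≥ -1`. Energy currents for `ψ` and
`r ψ` satisfy identities `∂_v density + ∂_r outflow + bulk = 0`. The energy of the Killing field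
degenerates at the horizon and has no bulk term; the redshift current repairs the degeneracy and has
a bulk term which is positive except for a zeroth order part decaying in `r`; a Morawetz current
absorbs that part, at the expense of a negative zeroth order density which a large multiple of the
Killing energy absorbs in turn; and divergences in the spirit of Hardy's inequality supply the
zeroth order terms of the flux. In the sum, the density is comparable to the integrand of the flux,
the bulk term bounds the density, and nothing enters through the horizon.

Multiplying the identity by `exp (c v)` and by the cutoff `1 - r / N` and integrating over
`[v₀, v] × [r₊, N]` leaves an error bounded by the average over `r ≤ N` of `r / N` times a density
which is integrable by the boundary condition at infinity, so that the error tends to `0` as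
`N → ∞`, and the energy decays exponentially. The pointwise bound follows by integrating the
derivative of `(2 - s / r) s³ ψ²` along the cone from `s = r` to `s = 2 r`.
-/

noncomputable section

namespace SchwarzschildAdS

variable {M l a rp r : ℝ}

/-- The coefficient `(1-μ)' / r + 2a/l²` of the zeroth order term in the wave equation satisfied by
`r ψ`. -/
def potential (M l a r : ℝ) : ℝ := 2 * M / r ^ 3 + 2 * (1 + a) / l ^ 2

section Background

theorem hasDerivAt_lapse (hr : r ≠ 0) :
    HasDerivAt (lapse M l) (2 * M / r ^ 2 + 2 * r / l ^ 2) r := by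
  have h := ((hasDerivAt_const r (1 : ℝ)).sub ((hasDerivAt_const r (2 * M)).div (hasDerivAt_id r)
    hr)).add ((hasDerivAt_pow 2 r).div_const (l ^ 2))
  refine h.congr_deriv ?_
  simp only [id_eq, zero_mul, mul_one, zero_sub, Nat.cast_ofNat, Nat.add_one_sub_one, pow_one,
    add_left_inj]
  ring

theorem hasDerivAt_potential (hr : r ≠ 0) :
    HasDerivAt (potential M l a) (-6 * M / r ^ 4) r := by
  have h := ((hasDerivAt_const r (2 * M)).div (hasDerivAt_pow 3 r) (pow_ne_zero 3 hr)).add_const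
    (2 * (1 + a) / l ^ 2)
  exact h.congr_deriv (by field_simp; norm_num; ring)

theorem potential_eq (hr : r ≠ 0) :
    potential M l a r = (2 * M / r ^ 2 + 2 * r / l ^ 2) / r + 2 * a / l ^ 2 := by
  unfold potential
  by_cases hl : l = 0
  · subst hl
    field_simp
    simp
  · field_simp
    ring

theorem sq_sub_sq_div_le_lapse (hl : 0 < l) (hrp : 0 < rp) (hhor : lapse M l rp = 0)
    (hr : rp ≤ r) : (r ^ 2 - rp ^ 2) / l ^ 2 ≤ lapse M l r := by
  have hr0 : 0 < r := hrp.trans_le hr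
  have h : lapse M l r =
      (r ^ 2 - rp ^ 2) / l ^ 2 + (r - rp) * (rp ^ 2 + l ^ 2) / (l ^ 2 * r) := by
    unfold lapse at *
    field_simp at hhor ⊢
    linear_combination hhor
  have : 0 ≤ (r - rp) * (rp ^ 2 + l ^ 2) / (l ^ 2 * r) :=
    div_nonneg (mul_nonneg (sub_nonneg.2 hr) (by positivity)) (by positivity)
  linarith

theorem lapse_nonneg (hl : 0 < l) (hrp : 0 < rp) (hhor : lapse M l rp = 0) (hr : rp ≤ r) :
    0 ≤ lapse M l r :=
  (div_nonneg (sub_nonneg.2 (by gcongr)) (sq_nonneg l)).trans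
    (sq_sub_sq_div_le_lapse hl hrp hhor hr)

theorem lapse_le (hM : 0 ≤ M) (hrp : 0 < rp) (hr : rp ≤ r) :
    lapse M l r ≤ (1 / rp ^ 2 + 1 / l ^ 2) * r ^ 2 := by
  have hr0 : 0 < r := hrp.trans_le hr
  have h1 : 0 ≤ 2 * M / r := by positivity
  have h2 : 1 ≤ r ^ 2 / rp ^ 2 := by
    rw [one_le_div (by positivity)]
    gcongr
  rw [lapse, add_mul, one_div_mul_eq_div, one_div_mul_eq_div]
  linarith

theorem potential_nonneg (hM : 0 ≤ M) (ha : -1 ≤ a) (hr : 0 ≤ r) : 0 ≤ potential M l a r := by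
  have : 0 ≤ 1 + a := by linarith
  unfold potential
  positivity

theorem potential_le (hM : 0 ≤ M) (hrp : 0 < rp) (hr : rp ≤ r) :
    potential M l a r ≤ potential M l a rp := by
  unfold potential
  gcongr

end Background

/-- A solution `ψ` of `□_g ψ - (2a/l²) ψ = 0` at the point `(v, r)`, with first derivatives `ψv`
and `ψr`, second derivatives `ψvr` and `ψrr`. -/
structure IsWaveJet (M l a : ℝ) (ψ ψv ψr : ℝ → ℝ → ℝ) (v r ψvr ψrr : ℝ) : Prop where
  deriv_v : HasDerivAt (fun w => ψ w r) (ψv v r) v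
  deriv_r : HasDerivAt (ψ v) (ψr v r) r
  deriv_v_r : HasDerivAt (ψv v) ψvr r
  deriv_r_v : HasDerivAt (fun w => ψr w r) ψvr v
  deriv_r_r : HasDerivAt (ψr v) ψrr r
  wave_eq : 2 * ψvr + 2 / r * ψv v r + lapse M l r * ψrr +
    (2 * M / r ^ 2 + 2 * r / l ^ 2 + 2 / r * lapse M l r) * ψr v r - 2 * a / l ^ 2 * ψ v r = 0

namespace IsWaveJet

variable {ψ ψv ψr : ℝ → ℝ → ℝ} {v ψvr ψrr : ℝ}

theorem mul_deriv_v (h : IsWaveJet M l a ψ ψv ψr v r ψvr ψrr) :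
    HasDerivAt (fun w => r * ψ w r) (r * ψv v r) v :=
  h.deriv_v.const_mul r

theorem mul_deriv_r (h : IsWaveJet M l a ψ ψv ψr v r ψvr ψrr) :
    HasDerivAt (fun s => s * ψ v s) (ψ v r + r * ψr v r) r :=
  ((hasDerivAt_id' r).fun_mul h.deriv_r).congr_deriv (by ring)

theorem mul_deriv_v_r (h : IsWaveJet M l a ψ ψv ψr v r ψvr ψrr) :
    HasDerivAt (fun s => s * ψv v s) (ψv v r + r * ψvr) r :=
  ((hasDerivAt_id' r).fun_mul h.deriv_v_r).congr_deriv (by ring)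

theorem mul_deriv_r_v (h : IsWaveJet M l a ψ ψv ψr v r ψvr ψrr) :
    HasDerivAt (fun w => ψ w r + r * ψr w r) (ψv v r + r * ψvr) v :=
  h.deriv_v.fun_add (h.deriv_r_v.const_mul r)

theorem mul_deriv_r_r (h : IsWaveJet M l a ψ ψv ψr v r ψvr ψrr) :
    HasDerivAt (fun s => ψ v s + s * ψr v s) (2 * ψr v r + r * ψrr) r :=
  (h.deriv_r.fun_add ((hasDerivAt_id' r).fun_mul h.deriv_r_r)).congr_deriv (by ring)

theorem mul_wave_eq (h : IsWaveJet M l a ψ ψv ψr v r ψvr ψrr) (hr : r ≠ 0) :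
    2 * (ψv v r + r * ψvr) + lapse M l r * (2 * ψr v r + r * ψrr) +
      (2 * M / r ^ 2 + 2 * r / l ^ 2) * (ψ v r + r * ψr v r) -
      potential M l a r * (r * ψ v r) = 0 := by
  rw [potential_eq hr, ← mul_zero r, ← h.wave_eq]
  field_simp
  ring

end IsWaveJet

/-- An energy current for spherically symmetric fields, evaluated on `r` and on the first order jet
`d = ψ_v`, `p = ψ_r`, `q = ψ`: the density on the cones of constant `v`, the flux through the
spheres of constant `r` in the direction of increasing `r`, and the bulk term of the identity
`∂_v density + ∂_r outflow + bulk = 0`. -/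
structure Current where
  density : ℝ → ℝ → ℝ → ℝ
  outflow : ℝ → ℝ → ℝ → ℝ → ℝ
  bulk : ℝ → ℝ → ℝ → ℝ → ℝ

namespace Current

instance : Add Current :=
  ⟨fun A B => ⟨A.density + B.density, A.outflow + B.outflow, A.bulk + B.bulk⟩⟩

instance : SMul ℝ Current := ⟨fun c A => ⟨c • A.density, c • A.outflow, c • A.bulk⟩⟩

/-- A current, `C¹` for `r > 0`, for which the identity `∂_v density + ∂_r outflow + bulk = 0` holds
for solutions of the wave equation. -/
structure IsConserved (M l a : ℝ) (A : Current) : Prop where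
  contDiffOn_density :
    ContDiffOn ℝ 1 (fun x : ℝ × ℝ × ℝ => A.density x.1 x.2.1 x.2.2) (Ioi 0 ×ˢ univ)
  contDiffOn_outflow : ContDiffOn ℝ 1
    (fun x : ℝ × ℝ × ℝ × ℝ => A.outflow x.1 x.2.1 x.2.2.1 x.2.2.2) (Ioi 0 ×ˢ univ)
  balance {ψ ψv ψr : ℝ → ℝ → ℝ} {v r ψvr ψrr : ℝ} (hr : 0 < r)
    (h : IsWaveJet M l a ψ ψv ψr v r ψvr ψrr) :
    ∃ e' J', HasDerivAt (fun w => A.density r (ψr w r) (ψ w r)) e' v ∧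
      HasDerivAt (fun s => A.outflow s (ψv v s) (ψr v s) (ψ v s)) J' r ∧
      e' + J' + A.bulk r (ψv v r) (ψr v r) (ψ v r) = 0

namespace IsConserved

variable {A B : Current}

theorem add (hA : A.IsConserved M l a) (hB : B.IsConserved M l a) : (A + B).IsConserved M l a where
  contDiffOn_density := hA.contDiffOn_density.add hB.contDiffOn_density
  contDiffOn_outflow := hA.contDiffOn_outflow.add hB.contDiffOn_outflow
  balance hr h := by
    obtain ⟨eA, JA, heA, hJA, hA0⟩ := hA.balance hr h
    obtain ⟨eB, JB, heB, hJB, hB0⟩ := hB.balance hr h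
    exact ⟨eA + eB, JA + JB, heA.add heB, hJA.add hJB, by
      change _ + (A.bulk _ _ _ _ + B.bulk _ _ _ _) = (0 : ℝ)
      linear_combination hA0 + hB0⟩

theorem smul (c : ℝ) (hA : A.IsConserved M l a) : (c • A).IsConserved M l a where
  contDiffOn_density := contDiffOn_const.mul hA.contDiffOn_density
  contDiffOn_outflow := contDiffOn_const.mul hA.contDiffOn_outflow
  balance hr h := by
    obtain ⟨e', J', he, hJ, h0⟩ := hA.balance hr h
    exact ⟨c * e', c * J', he.const_mul c, hJ.const_mul c, by
      change _ + c * A.bulk _ _ _ _ = (0 : ℝ)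
      linear_combination c * h0⟩

end IsConserved

end Current

/-- The current of the Killing field `∂_v` for the wave equation satisfied by `r ψ`. -/
def killingCurrent (M l a : ℝ) : Current where
  density r p q := lapse M l r * (q + r * p) ^ 2 + potential M l a r * (r * q) ^ 2
  outflow r d p q := -2 * (r * d) ^ 2 - 2 * lapse M l r * (q + r * p) * (r * d)
  bulk _ _ _ _ := 0

/-- The current of the multiplier `(1 + ε r) ∂_r`, at fixed `v`, for the wave equation satisfied by
`r ψ`. It does not degenerate at the horizon. -/
def redshiftCurrent (M l a ε : ℝ) : Current where
  density r p q := (1 + ε * r) * (q + r * p) ^ 2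
  outflow r _ p q :=
    (1 + ε * r) / 2 * (lapse M l r * (q + r * p) ^ 2 - potential M l a r * (r * q) ^ 2)
  bulk r _ p q :=
    ((1 + ε * r) * (2 * M / r ^ 2 + 2 * r / l ^ 2) - ε * lapse M l r) / 2 * (q + r * p) ^ 2 +
      (ε * potential M l a r + (1 + ε * r) * (-6 * M / r ^ 4)) / 2 * (r * q) ^ 2

/-- The current of the multiplier `r⁻² ∂_{r*}`, where `∂_{r*} = ∂_v + (1-μ) ∂_r`, for the wave
equation satisfied by `ψ`, corrected by the null divergence of `2 ψ² / l²` so as to complete the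
square in the bulk term. -/
def morawetzCurrent (M l a : ℝ) : Current where
  density r p q := lapse M l r / 2 * p ^ 2 - (a + 2) / l ^ 2 * q ^ 2
  outflow r d p q :=
    (d + lapse M l r * p) ^ 2 / 2 + d ^ 2 / 2 - (a + 2) / l ^ 2 * lapse M l r * q ^ 2
  bulk r d p q := 2 / r * (d + lapse M l r * p + r / l ^ 2 * q) ^ 2 +
    ((a + 2) * (2 * M) / (r ^ 2 * l ^ 2) + 2 * (a + 1) * r / l ^ 4) * q ^ 2

/-- The divergence of `-(r - rp) (r ψ)²` in `r`, the origin of Hardy's inequality. -/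
def hardyCurrent (rp : ℝ) : Current where
  density _ _ _ := 0
  outflow r _ _ q := -(r - rp) * (r * q) ^ 2
  bulk r _ p q := (r * q) ^ 2 + 2 * (r - rp) * (r * q) * (q + r * p)

/-- The trivially conserved current `(∂_r, -∂_v)` of the potential `(r - rp) (r ψ)²`. -/
def hardyKillingCurrent (rp : ℝ) : Current where
  density r p q := (r * q) ^ 2 + 2 * (r - rp) * (r * q) * (q + r * p)
  outflow r d _ q := -2 * (r - rp) * (r * q) * (r * d)
  bulk _ _ _ _ := 0

section Conserved

theorem isConserved_killingCurrent : (killingCurrent M l a).IsConserved M l a := by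
  refine ⟨?_, ?_, fun {ψ ψv ψr v r ψvr ψrr} hr h => ?_⟩
  · unfold killingCurrent lapse potential
    fun_prop (disch := exact fun x hx => by have : 0 < x.1 := hx.1; positivity)
  · unfold killingCurrent lapse
    fun_prop (disch := exact fun x hx => by have : 0 < x.1 := hx.1; positivity)
  · have hf := hasDerivAt_lapse (M := M) (l := l) hr.ne'
    refine ⟨_, _, ((h.mul_deriv_r_v.fun_pow 2).const_mul _).fun_add
      ((h.mul_deriv_v.fun_pow 2).const_mul _), ((h.mul_deriv_v_r.fun_pow 2).const_mul (-2)).fun_sub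
        (((hf.const_mul 2).fun_mul h.mul_deriv_r_r).fun_mul h.mul_deriv_v_r), ?_⟩
    simp only [killingCurrent]
    linear_combination (-2 * (r * ψv v r)) * h.mul_wave_eq hr.ne'

theorem isConserved_redshiftCurrent (ε : ℝ) : (redshiftCurrent M l a ε).IsConserved M l a := by
  refine ⟨?_, ?_, fun {ψ ψv ψr v r ψvr ψrr} hr h => ?_⟩
  · unfold redshiftCurrent
    fun_prop
  · unfold redshiftCurrent lapse potential
    fun_prop (disch := exact fun x hx => by have : 0 < x.1 := hx.1; positivity)
  · have hf := hasDerivAt_lapse (M := M) (l := l) hr.ne'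
    have hV := hasDerivAt_potential (M := M) (l := l) (a := a) hr.ne'
    have hh := (((hasDerivAt_id' r).const_mul ε).const_add 1).div_const 2
    refine ⟨_, _, (h.mul_deriv_r_v.fun_pow 2).const_mul _,
      hh.fun_mul ((hf.fun_mul (h.mul_deriv_r_r.fun_pow 2)).fun_sub
        (hV.fun_mul (h.mul_deriv_r.fun_pow 2))), ?_⟩
    simp only [redshiftCurrent]
    linear_combination ((1 + ε * r) * (ψ v r + r * ψr v r)) * h.mul_wave_eq hr.ne'

theorem isConserved_morawetzCurrent : (morawetzCurrent M l a).IsConserved M l a := by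
  refine ⟨?_, ?_, fun {ψ ψv ψr v r ψvr ψrr} hr h => ?_⟩
  · unfold morawetzCurrent lapse
    fun_prop (disch := exact fun x hx => by have : 0 < x.1 := hx.1; positivity)
  · unfold morawetzCurrent lapse
    fun_prop (disch := exact fun x hx => by have : 0 < x.1 := hx.1; positivity)
  · have hf := hasDerivAt_lapse (M := M) (l := l) hr.ne'
    refine ⟨_, _, ((h.deriv_r_v.fun_pow 2).const_mul _).fun_sub
      ((h.deriv_v.fun_pow 2).const_mul _),
      ((((h.deriv_v_r.fun_add (hf.fun_mul h.deriv_r_r)).fun_pow 2).div_const 2).fun_add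
        ((h.deriv_v_r.fun_pow 2).div_const 2)).fun_sub
        ((hf.const_mul _).fun_mul (h.deriv_r.fun_pow 2)), ?_⟩
    simp only [morawetzCurrent]
    linear_combination (ψv v r + lapse M l r * ψr v r) * h.wave_eq +
      (4 / l ^ 2 * (ψv v r + lapse M l r * ψr v r) * ψ v r + 2 * r / l ^ 4 * ψ v r ^ 2) *
        mul_inv_cancel₀ hr.ne'

theorem isConserved_hardyCurrent : (hardyCurrent rp).IsConserved M l a := by
  refine ⟨?_, ?_, fun {ψ ψv ψr v r ψvr ψrr} _ h => ?_⟩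
  · unfold hardyCurrent
    fun_prop
  · unfold hardyCurrent
    fun_prop
  · refine ⟨_, _, hasDerivAt_const v 0,
      ((hasDerivAt_id' r).sub_const rp).fun_neg.fun_mul (h.mul_deriv_r.fun_pow 2), ?_⟩
    simp only [hardyCurrent]
    ring

theorem isConserved_hardyKillingCurrent : (hardyKillingCurrent rp).IsConserved M l a := by
  refine ⟨?_, ?_, fun {ψ ψv ψr v r ψvr ψrr} _ h => ?_⟩
  · unfold hardyKillingCurrent
    fun_prop
  · unfold hardyKillingCurrent
    fun_prop
  · refine ⟨_, _, (h.mul_deriv_v.fun_pow 2).fun_add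
      ((h.mul_deriv_v.const_mul _).fun_mul h.mul_deriv_r_v),
      ((((hasDerivAt_id' r).sub_const rp).const_mul (-2)).fun_mul h.mul_deriv_r).fun_mul
        h.mul_deriv_v_r, ?_⟩
    simp only [hardyKillingCurrent]
    ring

end Conserved

section Coercivity

/-- The integrand `r⁴ (∂_r ψ)² + r² ψ²` of the energy flux, at `p = ∂_r ψ` and `q = ψ`. -/
def fluxDensity (r p q : ℝ) : ℝ := r ^ 4 * p ^ 2 + r ^ 2 * q ^ 2

/-- A current which has a coercive density outside the horizon `r = rp`, a bulk term bounding the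
density, no flux out of the horizon, and an inward flux growing at most linearly in `r`. -/
structure Current.IsCoercive (A : Current) (rp c₁ c₂ c₃ c₄ : ℝ) : Prop where
  le_density {r : ℝ} (hr : rp ≤ r) (p q : ℝ) : c₁ * fluxDensity r p q ≤ A.density r p q
  density_le {r : ℝ} (hr : rp ≤ r) (p q : ℝ) : A.density r p q ≤ c₂ * fluxDensity r p q
  density_le_bulk {r : ℝ} (hr : rp ≤ r) (d p q : ℝ) : c₄ * A.density r p q ≤ A.bulk r d p q
  outflow_horizon (d p q : ℝ) : A.outflow rp d p q ≤ 0
  neg_outflow_le {r : ℝ} (hr : rp ≤ r) (d p q : ℝ) :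
    -A.outflow r d p q ≤ c₃ * (r * ((r * d) ^ 2 + fluxDensity r p q))

/-- The weight of `morawetzCurrent` in `totalCurrent`, large enough for its bulk term to absorb the
negative zeroth order bulk term of `redshiftCurrent`. -/
def morawetzWeight (M l rp : ℝ) : ℝ := l ^ 2 * (3 / 2 + 16 * M / rp)

/-- The weight of `killingCurrent` in `totalCurrent`, large enough to absorb the negative zeroth
order part of the density of `morawetzCurrent` and its flux through the horizon. -/
def killingWeight (M l a rp : ℝ) : ℝ := 2 + 8 * morawetzWeight M l rp * (a + 2) / rp ^ 2

/-- The combination of currents that gives exponential decay. -/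
def totalCurrent (M l a rp : ℝ) : Current :=
  killingWeight M l a rp • (killingCurrent M l a + (1 / (4 * l ^ 2)) • hardyKillingCurrent rp) +
    redshiftCurrent M l a (rp / l ^ 2) + morawetzWeight M l rp • morawetzCurrent M l a +
      (rp / (8 * l ^ 4)) • hardyCurrent rp

theorem isConserved_totalCurrent : (totalCurrent M l a rp).IsConserved M l a :=
  ((((isConserved_killingCurrent.add (isConserved_hardyKillingCurrent.smul _)).smul _).add
    (isConserved_redshiftCurrent _)).add (isConserved_morawetzCurrent.smul _)).add
      (isConserved_hardyCurrent.smul _)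

theorem morawetzWeight_pos (hM : 0 ≤ M) (hl : 0 < l) (hrp : 0 < rp) :
    0 < morawetzWeight M l rp := by
  unfold morawetzWeight
  positivity

theorem two_le_killingWeight (hM : 0 ≤ M) (hl : 0 < l) (ha : -1 ≤ a) (hrp : 0 < rp) :
    2 ≤ killingWeight M l a rp := by
  have h1 := morawetzWeight_pos hM hl hrp
  have h2 : 0 ≤ a + 2 := by linarith
  unfold killingWeight
  exact le_add_of_nonneg_right (by positivity)

theorem fluxDensity_nonneg (r p q : ℝ) : 0 ≤ fluxDensity r p q := by
  unfold fluxDensity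
  positivity

theorem sq_mul_le_fluxDensity (r p q : ℝ) : (r * q) ^ 2 ≤ fluxDensity r p q := by
  rw [fluxDensity, mul_pow]
  exact le_add_of_nonneg_left (by positivity)

theorem sq_mul_add_le_fluxDensity (r p q : ℝ) :
    (r * (q + r * p)) ^ 2 ≤ 2 * fluxDensity r p q := by
  unfold fluxDensity
  linarith [sq_nonneg (r * q - r ^ 2 * p)]

theorem fluxDensity_le (r p q : ℝ) :
    fluxDensity r p q ≤ 2 * (r * (q + r * p)) ^ 2 + 3 * (r * q) ^ 2 := by
  unfold fluxDensity
  linarith [sq_nonneg (r ^ 2 * p + 2 * (r * q))]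

theorem sq_sub_le_mul_lapse (hl : 0 < l) (hrp : 0 < rp) (hhor : lapse M l rp = 0) (hr : rp ≤ r) :
    (r - rp) ^ 2 ≤ l ^ 2 * lapse M l r := by
  have h := sq_sub_sq_div_le_lapse hl hrp hhor hr
  rw [div_le_iff₀' (by positivity)] at h
  nlinarith

theorem sq_sub_mul_le (hrp : 0 ≤ rp) (hr : rp ≤ r) (x : ℝ) :
    ((r - rp) * x) ^ 2 ≤ (r * x) ^ 2 := by
  rw [mul_pow, mul_pow]
  gcongr
  linarith

section Density

theorem killing_density_ge (hM : 0 ≤ M) (hl : 0 < l) (ha : -1 ≤ a) (hrp : 0 < rp)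
    (hhor : lapse M l rp = 0) (hr : rp ≤ r) (p q : ℝ) :
    lapse M l r / 2 * (q + r * p) ^ 2 + (r * q) ^ 2 / (8 * l ^ 2) ≤
      (killingCurrent M l a + (1 / (4 * l ^ 2)) • hardyKillingCurrent rp).density r p q := by
  change _ ≤ lapse M l r * (q + r * p) ^ 2 + potential M l a r * (r * q) ^ 2 +
    1 / (4 * l ^ 2) * ((r * q) ^ 2 + 2 * (r - rp) * (r * q) * (q + r * p))
  set w := q + r * p
  set u := r * q
  have hpot : 0 ≤ potential M l a r * u ^ 2 :=
    mul_nonneg (potential_nonneg hM ha (hrp.le.trans hr)) (sq_nonneg u)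
  have hcross : -(u ^ 2 / 2 + 2 * (l ^ 2 * lapse M l r) * w ^ 2) ≤ 2 * (r - rp) * u * w := by
    have := mul_le_mul_of_nonneg_right (sq_sub_le_mul_lapse hl hrp hhor hr) (sq_nonneg w)
    linarith [sq_nonneg (u + 2 * (r - rp) * w)]
  calc lapse M l r / 2 * w ^ 2 + u ^ 2 / (8 * l ^ 2)
      = lapse M l r * w ^ 2 + 1 / (4 * l ^ 2) *
          (u ^ 2 + -(u ^ 2 / 2 + 2 * (l ^ 2 * lapse M l r) * w ^ 2)) := by field_simp; ring
    _ ≤ lapse M l r * w ^ 2 + 1 / (4 * l ^ 2) * (u ^ 2 + 2 * (r - rp) * u * w) := by gcongr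
    _ ≤ _ := by linarith

theorem redshift_density_ge (hl : 0 < l) (hrp : 0 < rp) (hhor : lapse M l rp = 0) (hr : rp ≤ r)
    (p q : ℝ) : (r * (q + r * p)) ^ 2 / l ^ 2 ≤
      lapse M l r * (q + r * p) ^ 2 + (redshiftCurrent M l a (rp / l ^ 2)).density r p q := by
  have hlapse := sq_sub_sq_div_le_lapse hl hrp hhor hr
  have hmul : rp * rp / l ^ 2 ≤ rp / l ^ 2 * r := by
    rw [div_mul_eq_mul_div]
    gcongr
  calc (r * (q + r * p)) ^ 2 / l ^ 2
      = ((r ^ 2 - rp ^ 2) / l ^ 2 + rp * rp / l ^ 2) * (q + r * p) ^ 2 := by ring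
    _ ≤ (lapse M l r + (1 + rp / l ^ 2 * r)) * (q + r * p) ^ 2 := by gcongr; linarith
    _ = _ := by simp only [redshiftCurrent]; ring

theorem morawetz_density_ge (hl : 0 < l) (ha : -1 ≤ a) (hrp : 0 < rp)
    (hhor : lapse M l rp = 0) (hr : rp ≤ r) (p q : ℝ) :
    -((a + 2) / (l ^ 2 * rp ^ 2) * (r * q) ^ 2) ≤ (morawetzCurrent M l a).density r p q := by
  have hf := lapse_nonneg hl hrp hhor hr
  have ha' : 0 ≤ a + 2 := by linarith
  calc -((a + 2) / (l ^ 2 * rp ^ 2) * (r * q) ^ 2)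
      ≤ -((a + 2) / (l ^ 2 * rp ^ 2) * (rp * q) ^ 2) := by
        simp only [mul_pow]
        gcongr
    _ = -((a + 2) / l ^ 2 * q ^ 2) := by field_simp
    _ ≤ _ := by
      simp only [morawetzCurrent]
      linarith [show 0 ≤ lapse M l r / 2 * p ^ 2 by positivity]

theorem le_totalCurrent_density (hM : 0 ≤ M) (hl : 0 < l) (ha : -1 ≤ a) (hrp : 0 < rp)
    (hhor : lapse M l rp = 0) (hr : rp ≤ r) (p q : ℝ) :
    1 / (12 * l ^ 2) * fluxDensity r p q ≤ (totalCurrent M l a rp).density r p q := by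
  change _ ≤ killingWeight M l a rp * _ + _ + morawetzWeight M l rp * _ +
    rp / (8 * l ^ 4) * (hardyCurrent rp).density r p q
  have hK := two_le_killingWeight hM hl ha hrp
  have hΛ := morawetzWeight_pos hM hl hrp
  have hkill := mul_le_mul_of_nonneg_left (killing_density_ge hM hl ha hrp hhor hr p q)
    (zero_le_two.trans hK)
  have hred := redshift_density_ge (a := a) hl hrp hhor hr p q
  have hmor := mul_le_mul_of_nonneg_left (morawetz_density_ge hl ha hrp hhor hr p q) hΛ.le
  have hlapse : lapse M l r * (q + r * p) ^ 2 ≤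
      killingWeight M l a rp * (lapse M l r / 2 * (q + r * p) ^ 2) := by
    have := lapse_nonneg hl hrp hhor hr
    nlinarith [show 0 ≤ lapse M l r / 2 * (q + r * p) ^ 2 by positivity]
  have hzeroth : killingWeight M l a rp * ((r * q) ^ 2 / (8 * l ^ 2)) -
      morawetzWeight M l rp * ((a + 2) / (l ^ 2 * rp ^ 2) * (r * q) ^ 2) =
        (r * q) ^ 2 / (4 * l ^ 2) := by
    unfold killingWeight
    field_simp
    ring
  have hD : 1 / (12 * l ^ 2) * fluxDensity r p q ≤
      (r * (q + r * p)) ^ 2 / l ^ 2 + (r * q) ^ 2 / (4 * l ^ 2) := by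
    calc 1 / (12 * l ^ 2) * fluxDensity r p q
        ≤ 1 / (12 * l ^ 2) * (12 * (r * (q + r * p)) ^ 2 + 3 * (r * q) ^ 2) := by
          gcongr
          linarith [fluxDensity_le r p q, sq_nonneg (r * (q + r * p))]
      _ = _ := by field_simp; ring
  have hhardy : rp / (8 * l ^ 4) * (hardyCurrent rp).density r p q = 0 := mul_zero _
  linarith

theorem lapse_mul_sq_le (hM : 0 ≤ M) (hrp : 0 < rp) (hr : rp ≤ r) (x : ℝ) :
    lapse M l r * x ^ 2 ≤ (1 / rp ^ 2 + 1 / l ^ 2) * (r * x) ^ 2 := by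
  rw [mul_pow, ← mul_assoc]
  gcongr
  exact lapse_le hM hrp hr

theorem potential_mul_sq_le (hM : 0 ≤ M) (ha : -1 ≤ a) (hrp : 0 < rp) (hr : rp ≤ r) (p q : ℝ) :
    potential M l a r * (r * q) ^ 2 ≤ potential M l a rp * fluxDensity r p q :=
  mul_le_mul (potential_le hM hrp hr) (sq_mul_le_fluxDensity r p q) (sq_nonneg _)
    (potential_nonneg hM ha hrp.le)

theorem one_add_mul_le (hl : 0 < l) (hrp : 0 < rp) (hr : rp ≤ r) :
    1 + rp / l ^ 2 * r ≤ (1 / rp ^ 2 + 1 / l ^ 2) * (rp * r) := by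
  have h : 1 ≤ r / rp := (one_le_div hrp).2 hr
  calc 1 + rp / l ^ 2 * r ≤ r / rp + rp / l ^ 2 * r := by gcongr
    _ = _ := by field_simp

theorem killing_density_le (hM : 0 ≤ M) (ha : -1 ≤ a) (hrp : 0 < rp) (hr : rp ≤ r) (p q : ℝ) :
    (killingCurrent M l a + (1 / (4 * l ^ 2)) • hardyKillingCurrent rp).density r p q ≤
      (2 * (1 / rp ^ 2 + 1 / l ^ 2) + potential M l a rp + 1 / l ^ 2) * fluxDensity r p q := by
  change lapse M l r * (q + r * p) ^ 2 + potential M l a r * (r * q) ^ 2 +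
    1 / (4 * l ^ 2) * ((r * q) ^ 2 + 2 * (r - rp) * (r * q) * (q + r * p)) ≤ _
  set w := q + r * p
  have hw : (r * w) ^ 2 ≤ 2 * fluxDensity r p q := sq_mul_add_le_fluxDensity r p q
  have hcross : (r * q) ^ 2 + 2 * (r - rp) * (r * q) * w ≤ 4 * fluxDensity r p q := by
    linarith [sq_nonneg (r * q - (r - rp) * w), sq_sub_mul_le hrp.le hr w,
      sq_mul_le_fluxDensity r p q]
  calc lapse M l r * w ^ 2 + potential M l a r * (r * q) ^ 2 +
        1 / (4 * l ^ 2) * ((r * q) ^ 2 + 2 * (r - rp) * (r * q) * w)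
      ≤ (1 / rp ^ 2 + 1 / l ^ 2) * (2 * fluxDensity r p q) +
          potential M l a rp * fluxDensity r p q + 1 / (4 * l ^ 2) * (4 * fluxDensity r p q) := by
        gcongr ?_ + ?_ + ?_ * ?_
        · exact (lapse_mul_sq_le hM hrp hr w).trans (by gcongr)
        · exact potential_mul_sq_le hM ha hrp hr p q
    _ = _ := by ring

theorem redshift_density_le (hl : 0 < l) (hrp : 0 < rp) (hr : rp ≤ r) (p q : ℝ) :
    (redshiftCurrent M l a (rp / l ^ 2)).density r p q ≤
      2 * (1 / rp ^ 2 + 1 / l ^ 2) * fluxDensity r p q := by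
  have hr0 : 0 < r := hrp.trans_le hr
  calc (1 + rp / l ^ 2 * r) * (q + r * p) ^ 2
      ≤ (1 / rp ^ 2 + 1 / l ^ 2) * (rp * r) * (q + r * p) ^ 2 := by
        gcongr
        exact one_add_mul_le hl hrp hr
    _ ≤ (1 / rp ^ 2 + 1 / l ^ 2) * (r * r) * (q + r * p) ^ 2 := by gcongr
    _ = (1 / rp ^ 2 + 1 / l ^ 2) * (r * (q + r * p)) ^ 2 := by ring
    _ ≤ (1 / rp ^ 2 + 1 / l ^ 2) * (2 * fluxDensity r p q) := by
        gcongr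
        exact sq_mul_add_le_fluxDensity r p q
    _ = _ := by ring

theorem morawetz_density_le (hM : 0 ≤ M) (ha : -1 ≤ a) (hrp : 0 < rp) (hr : rp ≤ r) (p q : ℝ) :
    (morawetzCurrent M l a).density r p q ≤
      (1 / rp ^ 2 + 1 / l ^ 2) / (2 * rp ^ 2) * fluxDensity r p q := by
  have ha' : 0 ≤ a + 2 := by linarith
  have hr0 : 0 < r := hrp.trans_le hr
  calc lapse M l r / 2 * p ^ 2 - (a + 2) / l ^ 2 * q ^ 2
      ≤ lapse M l r * p ^ 2 / 2 := by
        rw [div_mul_eq_mul_div]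
        exact sub_le_self _ (by positivity)
    _ ≤ (1 / rp ^ 2 + 1 / l ^ 2) * (r * p) ^ 2 / 2 := by
        gcongr ?_ / 2
        exact lapse_mul_sq_le hM hrp hr p
    _ = (1 / rp ^ 2 + 1 / l ^ 2) / (2 * rp ^ 2) * (rp ^ 2 * r ^ 2 * p ^ 2) := by field_simp
    _ ≤ (1 / rp ^ 2 + 1 / l ^ 2) / (2 * rp ^ 2) * (r ^ 2 * r ^ 2 * p ^ 2) := by gcongr
    _ ≤ _ := by
        gcongr
        unfold fluxDensity
        nlinarith [sq_nonneg (r * q)]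

theorem exists_totalCurrent_density_le (hM : 0 ≤ M) (hl : 0 < l) (ha : -1 ≤ a) (hrp : 0 < rp) :
    ∃ c₂ > 0, ∀ ⦃r : ℝ⦄, rp ≤ r → ∀ p q,
      (totalCurrent M l a rp).density r p q ≤ c₂ * fluxDensity r p q := by
  have hK := two_le_killingWeight hM hl ha hrp
  have hΛ := morawetzWeight_pos hM hl hrp
  have hV := potential_nonneg (l := l) hM ha hrp.le
  refine ⟨killingWeight M l a rp *
      (2 * (1 / rp ^ 2 + 1 / l ^ 2) + potential M l a rp + 1 / l ^ 2) +
    2 * (1 / rp ^ 2 + 1 / l ^ 2) +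
    morawetzWeight M l rp * ((1 / rp ^ 2 + 1 / l ^ 2) / (2 * rp ^ 2)), by positivity,
    fun r hr p q => ?_⟩
  change killingWeight M l a rp * _ + _ + morawetzWeight M l rp * _ +
    rp / (8 * l ^ 4) * (hardyCurrent rp).density r p q ≤ _
  rw [show (hardyCurrent rp).density r p q = 0 from rfl, mul_zero, add_zero, add_mul, add_mul,
    mul_assoc (killingWeight _ _ _ _), mul_assoc (morawetzWeight _ _ _)]
  gcongr
  · exact killing_density_le hM ha hrp hr p q
  · exact redshift_density_le hl hrp hr p q
  · exact morawetz_density_le hM ha hrp hr p q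

end Density

section Bulk

theorem redshift_bulk_ge (hM : 0 ≤ M) (hl : 0 < l) (ha : -1 ≤ a) (hrp : 0 < rp) (hr : rp ≤ r)
    (d p q : ℝ) :
    rp / (2 * l ^ 4) * (r * (q + r * p)) ^ 2 -
        (2 * M * rp / (l ^ 2 * r ^ 3) + 3 * M / r ^ 4) * (r * q) ^ 2 ≤
      (redshiftCurrent M l a (rp / l ^ 2)).bulk r d p q := by
  have hr0 : 0 < r := hrp.trans_le hr
  have ha' : 0 ≤ 1 + a := by linarith
  have hw : rp / (2 * l ^ 4) * r ^ 2 ≤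
      ((1 + rp / l ^ 2 * r) * (2 * M / r ^ 2 + 2 * r / l ^ 2) - rp / l ^ 2 * lapse M l r) / 2 := by
    have hrest : 0 ≤ M / r ^ 2 + rp / l ^ 2 * (2 * M / r) + (2 * r - rp) / (2 * l ^ 2) := by
      have : 0 ≤ 2 * r - rp := by linarith
      positivity
    refine (le_add_of_nonneg_right hrest).trans_eq ?_
    unfold lapse
    field_simp
    ring
  have hu : -(2 * M * rp / (l ^ 2 * r ^ 3) + 3 * M / r ^ 4) ≤
      (rp / l ^ 2 * potential M l a r + (1 + rp / l ^ 2 * r) * (-6 * M / r ^ 4)) / 2 := by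
    have hrest : 0 ≤ rp * (1 + a) / l ^ 4 := by positivity
    refine (le_add_of_nonneg_right hrest).trans_eq ?_
    unfold potential
    field_simp
    ring
  calc _ = rp / (2 * l ^ 4) * r ^ 2 * (q + r * p) ^ 2 +
        -(2 * M * rp / (l ^ 2 * r ^ 3) + 3 * M / r ^ 4) * (r * q) ^ 2 := by ring
    _ ≤ _ := add_le_add (mul_le_mul_of_nonneg_right hw (sq_nonneg _))
      (mul_le_mul_of_nonneg_right hu (sq_nonneg _))

theorem morawetz_bulk_ge (hM : 0 ≤ M) (ha : -1 ≤ a) (hr : 0 < r) (d p q : ℝ) :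
    2 * M / l ^ 2 * ((r * q) ^ 2 / r ^ 4) ≤ (morawetzCurrent M l a).bulk r d p q := by
  have ha' : 0 ≤ a + 1 := by linarith
  have hrest : 0 ≤ 2 / r * (d + lapse M l r * p + r / l ^ 2 * q) ^ 2 +
      ((a + 1) * (2 * M) / (r ^ 2 * l ^ 2) + 2 * (a + 1) * r / l ^ 4) * q ^ 2 := by positivity
  refine (le_add_of_nonneg_right hrest).trans_eq ?_
  have hrq : (r * q) ^ 2 / r ^ 4 = q ^ 2 / r ^ 2 := by field_simp
  simp only [hrq, morawetzCurrent]
  ring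

theorem hardy_bulk_ge (hrp : 0 ≤ rp) (hr : rp ≤ r) (d p q : ℝ) :
    (r * q) ^ 2 / 2 - 2 * (r * (q + r * p)) ^ 2 ≤ (hardyCurrent rp).bulk r d p q := by
  simp only [hardyCurrent]
  linarith [sq_nonneg (r * q + 2 * ((r - rp) * (q + r * p))), sq_sub_mul_le hrp hr (q + r * p)]

theorem totalCurrent_bulk_ge (hM : 0 ≤ M) (hl : 0 < l) (ha : -1 ≤ a) (hrp : 0 < rp) (hr : rp ≤ r)
    (d p q : ℝ) :
    rp / (96 * l ^ 4) * fluxDensity r p q ≤ (totalCurrent M l a rp).bulk r d p q := by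
  have hr0 : 0 < r := hrp.trans_le hr
  have hred := redshift_bulk_ge hM hl ha hrp hr d p q
  have hmor := mul_le_mul_of_nonneg_left (morawetz_bulk_ge (l := l) hM ha hr0 d p q)
    (morawetzWeight_pos hM hl hrp).le
  have hhardy := mul_le_mul_of_nonneg_left (hardy_bulk_ge hrp.le hr d p q)
    (show 0 ≤ rp / (8 * l ^ 4) by positivity)
  have hcoeff : rp / (32 * l ^ 4) ≤ rp / (16 * l ^ 4) -
      (2 * M * rp / (l ^ 2 * r ^ 3) + 3 * M / r ^ 4) +
        morawetzWeight M l rp * (2 * M / l ^ 2) / r ^ 4 := by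
    have hsq : 0 ≤ rp / 32 * (1 / l ^ 2 - 32 * M / (rp * r ^ 2)) ^ 2 +
        2 * M / (l ^ 2 * r ^ 2) * (1 - rp / r) := by
      have : 0 ≤ 1 - rp / r := sub_nonneg.2 ((div_le_one hr0).2 hr)
      positivity
    rw [← sub_nonneg]
    refine hsq.trans_eq ?_
    unfold morawetzWeight
    field_simp
    ring
  have hcoeff' := mul_le_mul_of_nonneg_right hcoeff (sq_nonneg (r * q))
  change _ ≤ killingWeight M l a rp * (0 + 1 / (4 * l ^ 2) * 0) + _ +
    morawetzWeight M l rp * (morawetzCurrent M l a).bulk r d p q +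
      rp / (8 * l ^ 4) * (hardyCurrent rp).bulk r d p q
  calc rp / (96 * l ^ 4) * fluxDensity r p q
      ≤ rp / (96 * l ^ 4) * (24 * (r * (q + r * p)) ^ 2 + 3 * (r * q) ^ 2) := by
        gcongr
        linarith [fluxDensity_le r p q, sq_nonneg (r * (q + r * p))]
    _ = rp / (4 * l ^ 4) * (r * (q + r * p)) ^ 2 + rp / (32 * l ^ 4) * (r * q) ^ 2 := by
        field_simp
        ring
    _ ≤ _ := by linear_combination hred + hmor + hhardy + hcoeff'

end Bulk

section Outflow

theorem totalCurrent_outflow_horizon (hM : 0 ≤ M) (hl : 0 < l) (ha : -1 ≤ a) (hrp : 0 < rp)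
    (hhor : lapse M l rp = 0) (d p q : ℝ) : (totalCurrent M l a rp).outflow rp d p q ≤ 0 := by
  have hΛ := morawetzWeight_pos hM hl hrp
  have hV := potential_nonneg (l := l) hM ha hrp.le
  have hpot : 0 ≤ (1 + rp / l ^ 2 * rp) / 2 * (potential M l a rp * (rp * q) ^ 2) := by positivity
  have hd : morawetzWeight M l rp * d ^ 2 ≤ killingWeight M l a rp * (2 * (rp * d) ^ 2) := by
    have h : killingWeight M l a rp * (2 * (rp * d) ^ 2) = morawetzWeight M l rp * d ^ 2 +
        (4 * rp ^ 2 + (15 + 16 * (a + 1)) * morawetzWeight M l rp) * d ^ 2 := by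
      unfold killingWeight
      field_simp
      ring
    have : 0 ≤ a + 1 := by linarith
    exact h ▸ le_add_of_nonneg_right (by positivity)
  change killingWeight M l a rp *
      ((-2 * (rp * d) ^ 2 - 2 * lapse M l rp * (q + rp * p) * (rp * d)) +
        1 / (4 * l ^ 2) * (-2 * (rp - rp) * (rp * q) * (rp * d))) +
    (1 + rp / l ^ 2 * rp) / 2 *
      (lapse M l rp * (q + rp * p) ^ 2 - potential M l a rp * (rp * q) ^ 2) +
    morawetzWeight M l rp * ((d + lapse M l rp * p) ^ 2 / 2 + d ^ 2 / 2 -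
      (a + 2) / l ^ 2 * lapse M l rp * q ^ 2) +
    rp / (8 * l ^ 4) * (-(rp - rp) * (rp * q) ^ 2) ≤ 0
  rw [hhor, sub_self]
  linarith

theorem killing_neg_outflow_le (hM : 0 ≤ M) (hl : 0 < l) (hrp : 0 < rp)
    (hhor : lapse M l rp = 0) (hr : rp ≤ r) (d p q : ℝ) :
    -(killingCurrent M l a).outflow r d p q ≤
      (2 / rp + 2 * (1 / rp ^ 2 + 1 / l ^ 2)) * (r * ((r * d) ^ 2 + fluxDensity r p q)) := by
  have hr0 : 0 < r := hrp.trans_le hr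
  set c := 1 / rp ^ 2 + 1 / l ^ 2
  set w := q + r * p
  have hf := lapse_nonneg hl hrp hhor hr
  have hw : (r * w) ^ 2 ≤ 2 * fluxDensity r p q := sq_mul_add_le_fluxDensity r p q
  have hD := fluxDensity_nonneg r p q
  have hkin : 2 * (r * d) ^ 2 ≤ 2 / rp * (r * (r * d) ^ 2) := by
    have : 1 ≤ r / rp := (one_le_div hrp).2 hr
    calc 2 * (r * d) ^ 2 ≤ 2 * (r / rp * (r * d) ^ 2) := by
          gcongr
          exact le_mul_of_one_le_left (sq_nonneg _) this
      _ = _ := by ring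
  have hcross : 2 * lapse M l r * w * (r * d) ≤ c * (r * ((r * w) ^ 2 + (r * d) ^ 2)) := by
    calc 2 * lapse M l r * w * (r * d) ≤ lapse M l r * (r * w ^ 2 + r * d ^ 2) := by
          nlinarith [mul_nonneg hf (mul_nonneg hr0.le (sq_nonneg (w - d)))]
      _ ≤ c * r ^ 2 * (r * w ^ 2 + r * d ^ 2) := by
          gcongr
          exact lapse_le hM hrp hr
      _ = _ := by ring
  calc -(-2 * (r * d) ^ 2 - 2 * lapse M l r * w * (r * d))
      = 2 * (r * d) ^ 2 + 2 * lapse M l r * w * (r * d) := by ring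
    _ ≤ 2 / rp * (r * ((r * d) ^ 2 + fluxDensity r p q)) +
        c * (r * (2 * fluxDensity r p q + 2 * (r * d) ^ 2)) := by
      gcongr ?_ + ?_
      · exact hkin.trans (by gcongr; linarith)
      · refine hcross.trans ?_
        gcongr
        linarith [sq_nonneg (r * d)]
    _ = _ := by ring

theorem hardyKilling_neg_outflow_le (hrp : 0 ≤ rp) (hr : rp ≤ r) (d p q : ℝ) :
    -(hardyKillingCurrent rp).outflow r d p q ≤ r * ((r * d) ^ 2 + fluxDensity r p q) := by
  have hu := sq_mul_le_fluxDensity r p q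
  calc -(-2 * (r - rp) * (r * q) * (r * d)) ≤ (r - rp) * ((r * d) ^ 2 + (r * q) ^ 2) := by
        nlinarith [mul_nonneg (sub_nonneg.2 hr) (sq_nonneg (r * d - r * q))]
    _ ≤ _ := by gcongr <;> linarith

theorem redshift_neg_outflow_le (hM : 0 ≤ M) (hl : 0 < l) (ha : -1 ≤ a) (hrp : 0 < rp)
    (hhor : lapse M l rp = 0) (hr : rp ≤ r) (d p q : ℝ) :
    -(redshiftCurrent M l a (rp / l ^ 2)).outflow r d p q ≤
      (1 / rp ^ 2 + 1 / l ^ 2) * rp * potential M l a rp / 2 * (r * fluxDensity r p q) := by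
  have hr0 : 0 < r := hrp.trans_le hr
  have hf := lapse_nonneg hl hrp hhor hr
  have hlapse : 0 ≤ (1 + rp / l ^ 2 * r) / 2 * (lapse M l r * (q + r * p) ^ 2) := by positivity
  calc -((1 + rp / l ^ 2 * r) / 2 *
        (lapse M l r * (q + r * p) ^ 2 - potential M l a r * (r * q) ^ 2))
      ≤ (1 + rp / l ^ 2 * r) / 2 * (potential M l a r * (r * q) ^ 2) := by linarith
    _ ≤ (1 / rp ^ 2 + 1 / l ^ 2) * (rp * r) / 2 *
          (potential M l a rp * fluxDensity r p q) := by
        gcongr ?_ / 2 * ?_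
        · exact mul_nonneg (potential_nonneg hM ha hr0.le) (sq_nonneg _)
        · exact one_add_mul_le hl hrp hr
        · exact potential_mul_sq_le hM ha hrp hr p q
    _ = _ := by ring

theorem morawetz_neg_outflow_le (hM : 0 ≤ M) (ha : -1 ≤ a) (hrp : 0 < rp) (hr : rp ≤ r)
    (d p q : ℝ) :
    -(morawetzCurrent M l a).outflow r d p q ≤
      (a + 2) / (l ^ 2 * rp) * (1 / rp ^ 2 + 1 / l ^ 2) * (r * fluxDensity r p q) := by
  have hr0 : 0 < r := hrp.trans_le hr
  have ha' : 0 ≤ a + 2 := by linarith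
  have hrr : 1 ≤ r / rp := (one_le_div hrp).2 hr
  have hu : (r * q) ^ 2 ≤ r / rp * fluxDensity r p q :=
    (sq_mul_le_fluxDensity r p q).trans
      (le_mul_of_one_le_left (fluxDensity_nonneg r p q) hrr)
  calc -((d + lapse M l r * p) ^ 2 / 2 + d ^ 2 / 2 - (a + 2) / l ^ 2 * lapse M l r * q ^ 2)
      ≤ (a + 2) / l ^ 2 * (lapse M l r * q ^ 2) := by
        linarith [sq_nonneg (d + lapse M l r * p), sq_nonneg d]
    _ ≤ (a + 2) / l ^ 2 * ((1 / rp ^ 2 + 1 / l ^ 2) * (r * q) ^ 2) := by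
        gcongr _ * ?_
        exact lapse_mul_sq_le hM hrp hr q
    _ ≤ (a + 2) / l ^ 2 * ((1 / rp ^ 2 + 1 / l ^ 2) * (r / rp * fluxDensity r p q)) := by
        gcongr
    _ = _ := by field_simp

theorem hardy_neg_outflow_le (hrp : 0 ≤ rp) (hr : rp ≤ r) (d p q : ℝ) :
    -(hardyCurrent rp).outflow r d p q ≤ r * fluxDensity r p q := by
  calc -(-(r - rp) * (r * q) ^ 2) = (r - rp) * (r * q) ^ 2 := by ring
    _ ≤ r * fluxDensity r p q :=
      mul_le_mul (sub_le_self r hrp) (sq_mul_le_fluxDensity r p q) (sq_nonneg _) (hrp.trans hr)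

theorem exists_totalCurrent_neg_outflow_le (hM : 0 ≤ M) (hl : 0 < l) (ha : -1 ≤ a) (hrp : 0 < rp)
    (hhor : lapse M l rp = 0) :
    ∃ c₃ > 0, ∀ ⦃r : ℝ⦄, rp ≤ r → ∀ d p q, -(totalCurrent M l a rp).outflow r d p q ≤
      c₃ * (r * ((r * d) ^ 2 + fluxDensity r p q)) := by
  have hK := two_le_killingWeight hM hl ha hrp
  have hΛ := morawetzWeight_pos hM hl hrp
  have hV := potential_nonneg (l := l) hM ha hrp.le
  have ha' : 0 ≤ a + 2 := by linarith
  set c := 1 / rp ^ 2 + 1 / l ^ 2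
  refine ⟨killingWeight M l a rp * (2 / rp + 2 * c + 1 / (4 * l ^ 2)) +
    c * rp * potential M l a rp / 2 + morawetzWeight M l rp * ((a + 2) / (l ^ 2 * rp) * c) +
      rp / (8 * l ^ 4), by positivity, fun r hr d p q => ?_⟩
  set S := r * ((r * d) ^ 2 + fluxDensity r p q)
  have hDS : r * fluxDensity r p q ≤ S := by
    have := hrp.trans_le hr
    exact mul_le_mul_of_nonneg_left (le_add_of_nonneg_left (sq_nonneg _)) this.le
  calc -(totalCurrent M l a rp).outflow r d p q
      = killingWeight M l a rp * (-(killingCurrent M l a).outflow r d p q +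
            1 / (4 * l ^ 2) * -(hardyKillingCurrent rp).outflow r d p q) +
          -(redshiftCurrent M l a (rp / l ^ 2)).outflow r d p q +
          morawetzWeight M l rp * -(morawetzCurrent M l a).outflow r d p q +
          rp / (8 * l ^ 4) * -(hardyCurrent rp).outflow r d p q := by
        change -(killingWeight M l a rp * (_ + 1 / (4 * l ^ 2) * _) + _ +
          morawetzWeight M l rp * _ + rp / (8 * l ^ 4) * _) = _
        ring
    _ ≤ killingWeight M l a rp * ((2 / rp + 2 * c) * S + 1 / (4 * l ^ 2) * S) +
          c * rp * potential M l a rp / 2 * S +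
          morawetzWeight M l rp * ((a + 2) / (l ^ 2 * rp) * c * S) + rp / (8 * l ^ 4) * S := by
        gcongr
        · exact killing_neg_outflow_le hM hl hrp hhor hr d p q
        · exact hardyKilling_neg_outflow_le hrp.le hr d p q
        · exact (redshift_neg_outflow_le hM hl ha hrp hhor hr d p q).trans (by gcongr)
        · exact (morawetz_neg_outflow_le hM ha hrp hr d p q).trans (by gcongr)
        · exact (hardy_neg_outflow_le hrp.le hr d p q).trans hDS
    _ = _ := by ring

end Outflow

theorem exists_isConserved_isCoercive (hM : 0 ≤ M) (hl : 0 < l) (ha : -1 ≤ a) (hrp : 0 < rp)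
    (hhor : lapse M l rp = 0) :
    ∃ (A : Current) (c₁ c₂ c₃ c₄ : ℝ), 0 < c₁ ∧ 0 < c₂ ∧ 0 < c₃ ∧ 0 < c₄ ∧
      A.IsConserved M l a ∧ A.IsCoercive rp c₁ c₂ c₃ c₄ := by
  obtain ⟨c₂, hc₂, hupper⟩ := exists_totalCurrent_density_le hM hl ha hrp
  obtain ⟨c₃, hc₃, hflux⟩ := exists_totalCurrent_neg_outflow_le hM hl ha hrp hhor
  refine ⟨totalCurrent M l a rp, 1 / (12 * l ^ 2), c₂, c₃, rp / (96 * l ^ 4) / c₂, by positivity,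
    hc₂, hc₃, by positivity, isConserved_totalCurrent,
    fun hr => le_totalCurrent_density hM hl ha hrp hhor hr, fun hr => hupper hr,
    fun {r} hr d p q => ?_, totalCurrent_outflow_horizon hM hl ha hrp hhor, fun hr => hflux hr⟩
  calc rp / (96 * l ^ 4) / c₂ * (totalCurrent M l a rp).density r p q
      ≤ rp / (96 * l ^ 4) / c₂ * (c₂ * fluxDensity r p q) := by
        gcongr
        exact hupper hr p q
    _ = rp / (96 * l ^ 4) * fluxDensity r p q := by field_simp
    _ ≤ _ := totalCurrent_bulk_ge hM hl ha hrp hr d p q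

end Coercivity

section WaveOperator

open Filter Topology

theorem metric_inv {y : Fin 4 → ℝ} (h1 : y 1 ≠ 0) (h2 : Real.sin (y 2) ≠ 0) :
    (metric M l y)⁻¹ = !![0, 1, 0, 0; 1, lapse M l (y 1), 0, 0; 0, 0, ((y 1) ^ 2)⁻¹, 0;
      0, 0, 0, ((y 1) ^ 2 * Real.sin (y 2) ^ 2)⁻¹] := by
  apply Matrix.inv_eq_right_inv
  ext i j
  fin_cases i <;> fin_cases j <;>
    simp [metric, Matrix.mul_apply, Fin.sum_univ_four, h1]
  field_simp

theorem det_metric (y : Fin 4 → ℝ) :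
    (metric M l y).det = -((y 1) ^ 2 * Real.sin (y 2)) ^ 2 := by
  simp [metric, Matrix.det_succ_row_zero, Fin.sum_univ_succ, Fin.succAbove]
  ring

theorem sqrt_abs_det_metric {y : Fin 4 → ℝ} (h2 : 0 ≤ Real.sin (y 2)) :
    Real.sqrt |(metric M l y).det| = (y 1) ^ 2 * Real.sin (y 2) := by
  rw [det_metric, abs_neg, abs_of_nonneg (sq_nonneg _), Real.sqrt_sq (by positivity)]

theorem coordDeriv_congr {F G : (Fin 4 → ℝ) → ℝ} {x : Fin 4 → ℝ} (h : F =ᶠ[𝓝 x] G) (μ : Fin 4) :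
    coordDeriv μ F x = coordDeriv μ G x := by
  have hcont : Tendsto (Function.update x μ) (𝓝 (x μ)) (𝓝 x) := by
    simpa using (continuous_const.update μ continuous_id (f := fun _ => x)).tendsto (x μ)
  exact Filter.EventuallyEq.deriv_eq (hcont.eventually h)

theorem sqrt_det_mul_gradient_symmField (Ψ : ℝ → ℝ → ℝ) {y : Fin 4 → ℝ} (h1 : y 1 ≠ 0)
    (h2 : 0 < Real.sin (y 2)) (μ : Fin 4) :
    Real.sqrt |(metric M l y).det| * ∑ ν, (metric M l y)⁻¹ μ ν * coordDeriv ν (symmField Ψ) y =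
      (y 1) ^ 2 * Real.sin (y 2) * ![deriv (Ψ (y 0)) (y 1),
        deriv (fun w => Ψ w (y 1)) (y 0) + lapse M l (y 1) * deriv (Ψ (y 0)) (y 1), 0, 0] μ := by
  rw [sqrt_abs_det_metric h2.le, metric_inv h1 h2.ne']
  fin_cases μ <;> simp [Fin.sum_univ_four, coordDeriv, symmField]

theorem waveOp_symmField {Ψ : ℝ → ℝ → ℝ} {x : Fin 4 → ℝ} (hx1 : x 1 ≠ 0)
    (hx2 : 0 < Real.sin (x 2)) {ψvr ψrv ψrr : ℝ}
    (hvr : HasDerivAt (fun s => deriv (fun w => Ψ w s) (x 0)) ψvr (x 1))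
    (hrv : HasDerivAt (fun w => deriv (Ψ w) (x 1)) ψrv (x 0))
    (hrr : HasDerivAt (deriv (Ψ (x 0))) ψrr (x 1)) :
    waveOp (metric M l) (symmField Ψ) x =
      ψvr + ψrv + 2 / x 1 * deriv (fun w => Ψ w (x 1)) (x 0) + lapse M l (x 1) * ψrr +
        (2 * M / x 1 ^ 2 + 2 * x 1 / l ^ 2 + 2 / x 1 * lapse M l (x 1)) *
          deriv (Ψ (x 0)) (x 1) := by
  have hnear : ∀ᶠ y in 𝓝 x, y 1 ≠ 0 ∧ 0 < Real.sin (y 2) :=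
    ((continuous_apply 1).continuousAt.eventually_ne hx1).and
      (((Real.continuous_sin.comp (continuous_apply 2)).tendsto x).eventually_const_lt hx2)
  have hgrad : ∀ μ, coordDeriv μ (fun y => Real.sqrt |(metric M l y).det| *
      ∑ ν, (metric M l y)⁻¹ μ ν * coordDeriv ν (symmField Ψ) y) x = _ := fun μ =>
    coordDeriv_congr (hnear.mono fun y hy => sqrt_det_mul_gradient_symmField Ψ hy.1 hy.2 μ) μ
  have hv := (hrv.const_mul (x 1 ^ 2 * Real.sin (x 2))).deriv
  have hr := (((hasDerivAt_pow 2 (x 1)).mul_const (Real.sin (x 2))).fun_mul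
    (hvr.fun_add ((hasDerivAt_lapse (M := M) (l := l) hx1).fun_mul hrr))).deriv
  rw [waveOp, Finset.sum_congr rfl fun μ _ => hgrad μ, sqrt_abs_det_metric hx2.le,
    Fin.sum_univ_four]
  simp only [mul_inv_rev, coordDeriv, ne_eq, one_ne_zero, not_false_eq_true,
    Function.update_of_ne, Fin.reduceEq, Nat.succ_eq_add_one, Nat.reduceAdd, Function.update_self,
    Matrix.cons_val_zero, hv, zero_ne_one, Matrix.cons_val_one, hr, Nat.cast_ofNat,
    Nat.add_one_sub_one, pow_one, Matrix.cons_val, mul_zero, deriv_const', add_zero, Fin.isValue]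
  field_simp
  ring

end WaveOperator

section Slices

variable {f : ℝ → ℝ → ℝ} {s : Set (ℝ × ℝ)} {v d : ℝ}

theorem hasDerivWithinAt_fst (hf : DifferentiableOn ℝ (fun p : ℝ × ℝ => f p.1 p.2) s)
    (hs : (v, r) ∈ s) :
    HasDerivWithinAt (fun w => f w r) (fderivWithin ℝ (fun p : ℝ × ℝ => f p.1 p.2) s (v, r) (1, 0))
      {w | (w, r) ∈ s} v := by
  have hline : HasDerivWithinAt (fun w => (w, r)) ((1 : ℝ), (0 : ℝ)) {w | (w, r) ∈ s} v :=
    (hasDerivWithinAt_id v _).prodMk (hasDerivWithinAt_const v _ r)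
  exact (hf _ hs).hasFDerivWithinAt.comp_hasDerivWithinAt v hline fun _ hw => hw

theorem hasDerivWithinAt_snd (hf : DifferentiableOn ℝ (fun p : ℝ × ℝ => f p.1 p.2) s)
    (hs : (v, r) ∈ s) :
    HasDerivWithinAt (f v) (fderivWithin ℝ (fun p : ℝ × ℝ => f p.1 p.2) s (v, r) (0, 1))
      {t | (v, t) ∈ s} r := by
  have hline : HasDerivWithinAt (fun t => (v, t)) ((0 : ℝ), (1 : ℝ)) {t | (v, t) ∈ s} r :=
    (hasDerivWithinAt_const r _ v).prodMk (hasDerivWithinAt_id r _)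
  exact (hf _ hs).hasFDerivWithinAt.comp_hasDerivWithinAt r hline fun _ ht => ht

theorem fderivWithin_apply_fst
    (hf : DifferentiableOn ℝ (fun p : ℝ × ℝ => f p.1 p.2) s)
    (hs : s ∈ nhds (v, r)) (hd : HasDerivAt (fun w => f w r) d v) :
    fderivWithin ℝ (fun p : ℝ × ℝ => f p.1 p.2) s (v, r) (1, 0) = d :=
  ((hasDerivWithinAt_fst hf (mem_of_mem_nhds hs)).hasDerivAt
    ((Continuous.prodMk_left r).continuousAt.preimage_mem_nhds hs)).unique hd

theorem fderivWithin_apply_snd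
    (hf : DifferentiableOn ℝ (fun p : ℝ × ℝ => f p.1 p.2) s)
    (hs : s ∈ nhds (v, r)) (hd : HasDerivAt (f v) d r) :
    fderivWithin ℝ (fun p : ℝ × ℝ => f p.1 p.2) s (v, r) (0, 1) = d :=
  ((hasDerivWithinAt_snd hf (mem_of_mem_nhds hs)).hasDerivAt
    ((Continuous.prodMk_right v).continuousAt.preimage_mem_nhds hs)).unique hd

end Slices

/-- The radial derivative at fixed `v`, one-sided on the horizon `r = rp`. -/
def radialDeriv (rp : ℝ) (Ψ : ℝ → ℝ → ℝ) (v r : ℝ) : ℝ :=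
  derivWithin (Ψ v) (Ici rp) r

section PartialDerivatives

variable {v0 v : ℝ} {Ψ : ℝ → ℝ → ℝ}

theorem killingDeriv_eq_deriv (hv : v0 < v) : killingDeriv v0 Ψ v r = deriv (fun w => Ψ w r) v :=
  derivWithin_of_mem_nhds (Ici_mem_nhds hv)

theorem radialDeriv_eq_deriv (hr : rp < r) : radialDeriv rp Ψ v r = deriv (Ψ v) r :=
  derivWithin_of_mem_nhds (Ici_mem_nhds hr)

theorem uniqueDiffOn_exterior : UniqueDiffOn ℝ (Ici v0 ×ˢ Ici rp) :=
  (uniqueDiffOn_Ici v0).prod (uniqueDiffOn_Ici rp)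

theorem killingDeriv_eq_fderivWithin
    (hΨ : DifferentiableOn ℝ (fun p : ℝ × ℝ => Ψ p.1 p.2) (Ici v0 ×ˢ Ici rp))
    (hv : v0 ≤ v) (hr : rp ≤ r) : killingDeriv v0 Ψ v r =
    fderivWithin ℝ (fun p : ℝ × ℝ => Ψ p.1 p.2) (Ici v0 ×ˢ Ici rp) (v, r) (1, 0) :=
  ((hasDerivWithinAt_fst hΨ ⟨hv, hr⟩).mono fun _ hw => mk_mem_prod hw hr).derivWithin
    (uniqueDiffOn_Ici v0 v hv)

theorem radialDeriv_eq_fderivWithin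
    (hΨ : DifferentiableOn ℝ (fun p : ℝ × ℝ => Ψ p.1 p.2) (Ici v0 ×ˢ Ici rp))
    (hv : v0 ≤ v) (hr : rp ≤ r) : radialDeriv rp Ψ v r =
    fderivWithin ℝ (fun p : ℝ × ℝ => Ψ p.1 p.2) (Ici v0 ×ˢ Ici rp) (v, r) (0, 1) :=
  ((hasDerivWithinAt_snd hΨ ⟨hv, hr⟩).mono fun _ hs => mk_mem_prod hv hs).derivWithin
    (uniqueDiffOn_Ici rp r hr)

theorem hasDerivAt_killingDeriv
    (hΨ : DifferentiableOn ℝ (fun p : ℝ × ℝ => Ψ p.1 p.2) (Ici v0 ×ˢ Ici rp))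
    (hv : v0 < v) (hr : rp ≤ r) :
    HasDerivAt (fun w => Ψ w r) (killingDeriv v0 Ψ v r) v := by
  rw [killingDeriv_eq_fderivWithin hΨ hv.le hr]
  exact (hasDerivWithinAt_fst hΨ ⟨hv.le, hr⟩).hasDerivAt
    (Filter.mem_of_superset (Ici_mem_nhds hv) fun _ hw => mk_mem_prod hw hr)

theorem hasDerivAt_radialDeriv
    (hΨ : DifferentiableOn ℝ (fun p : ℝ × ℝ => Ψ p.1 p.2) (Ici v0 ×ˢ Ici rp))
    (hv : v0 ≤ v) (hr : rp < r) :
    HasDerivAt (Ψ v) (radialDeriv rp Ψ v r) r := by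
  rw [radialDeriv_eq_fderivWithin hΨ hv hr.le]
  exact (hasDerivWithinAt_snd hΨ ⟨hv, hr.le⟩).hasDerivAt
    (Filter.mem_of_superset (Ici_mem_nhds hr) fun _ hs => mk_mem_prod hv hs)

theorem contDiffOn_killingDeriv
    (hΨ : ContDiffOn ℝ 2 (fun p : ℝ × ℝ => Ψ p.1 p.2) (Ici v0 ×ˢ Ici rp)) :
    ContDiffOn ℝ 1 (fun p : ℝ × ℝ => killingDeriv v0 Ψ p.1 p.2) (Ici v0 ×ˢ Ici rp) :=
  ((hΨ.fderivWithin uniqueDiffOn_exterior (m := 1) (by norm_num)).clm_apply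
    (contDiffOn_const (c := ((1 : ℝ), (0 : ℝ))))).congr fun _ hp =>
      killingDeriv_eq_fderivWithin (hΨ.differentiableOn two_ne_zero) hp.1 hp.2

theorem contDiffOn_radialDeriv
    (hΨ : ContDiffOn ℝ 2 (fun p : ℝ × ℝ => Ψ p.1 p.2) (Ici v0 ×ˢ Ici rp)) :
    ContDiffOn ℝ 1 (fun p : ℝ × ℝ => radialDeriv rp Ψ p.1 p.2) (Ici v0 ×ˢ Ici rp) :=
  ((hΨ.fderivWithin uniqueDiffOn_exterior (m := 1) (by norm_num)).clm_apply
    (contDiffOn_const (c := ((0 : ℝ), (1 : ℝ))))).congr fun _ hp =>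
      radialDeriv_eq_fderivWithin (hΨ.differentiableOn two_ne_zero) hp.1 hp.2

theorem killingDeriv_radialDeriv
    (hΨ : ContDiffOn ℝ 2 (fun p : ℝ × ℝ => Ψ p.1 p.2) (Ici v0 ×ˢ Ici rp))
    (hv : v0 < v) (hr : rp < r) :
    killingDeriv v0 (radialDeriv rp Ψ) v r = radialDeriv rp (killingDeriv v0 Ψ) v r := by
  set S := Ici v0 ×ˢ Ici rp
  set D := fderivWithin ℝ (fun p : ℝ × ℝ => Ψ p.1 p.2) S
  have hΨ' := hΨ.differentiableOn two_ne_zero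
  have hp : (v, r) ∈ S := ⟨hv.le, hr.le⟩
  have hS : S ∈ nhds (v, r) := prod_mem_nhds (Ici_mem_nhds hv) (Ici_mem_nhds hr)
  have hD : DifferentiableWithinAt ℝ D S (v, r) :=
    (hΨ.fderivWithin uniqueDiffOn_exterior (m := 1) (by norm_num)).differentiableOn one_ne_zero _ hp
  have hcomp (u w : ℝ × ℝ) :
      fderivWithin ℝ (fun p => D p u) S (v, r) w = fderivWithin ℝ D S (v, r) w u := by
    rw [(hD.hasFDerivWithinAt.clm_apply (hasFDerivWithinAt_const u (v, r) S)).fderivWithin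
      (uniqueDiffOn_exterior _ hp)]
    simp
  have hsymm : IsSymmSndFDerivWithinAt ℝ (fun p : ℝ × ℝ => Ψ p.1 p.2) S (v, r) :=
    (hΨ.contDiffWithinAt hp).isSymmSndFDerivWithinAt (by simp)
      uniqueDiffOn_exterior (subset_closure (mem_interior_iff_mem_nhds.2 hS)) hp
  rw [killingDeriv_eq_fderivWithin
      ((contDiffOn_radialDeriv hΨ).differentiableOn one_ne_zero) hv.le hr.le,
    radialDeriv_eq_fderivWithin
      ((contDiffOn_killingDeriv hΨ).differentiableOn one_ne_zero) hv.le hr.le,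
    fderivWithin_congr' (fun p hp => radialDeriv_eq_fderivWithin hΨ' hp.1 hp.2) hp,
    fderivWithin_congr' (fun p hp => killingDeriv_eq_fderivWithin hΨ' hp.1 hp.2) hp,
    hcomp, hcomp]
  exact hsymm (1, 0) (0, 1)

theorem IsSolution.isWaveJet (h : IsSolution M l a rp v0 Ψ) (hrp : 0 < rp) (hv : v0 < v)
    (hr : rp < r) :
    IsWaveJet M l a Ψ (killingDeriv v0 Ψ) (radialDeriv rp Ψ) v r
      (radialDeriv rp (killingDeriv v0 Ψ) v r) (radialDeriv rp (radialDeriv rp Ψ) v r) := by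
  have hΨ := h.contDiffOn.differentiableOn two_ne_zero
  have hψv := (contDiffOn_killingDeriv h.contDiffOn).differentiableOn one_ne_zero
  have hψr := (contDiffOn_radialDeriv h.contDiffOn).differentiableOn one_ne_zero
  have hvr := hasDerivAt_radialDeriv hψv hv.le hr
  have hrv := hasDerivAt_killingDeriv hψr hv hr.le
  have hrr := hasDerivAt_radialDeriv hψr hv.le hr
  rw [killingDeriv_radialDeriv h.contDiffOn hv hr] at hrv
  refine ⟨hasDerivAt_killingDeriv hΨ hv hr.le, hasDerivAt_radialDeriv hΨ hv.le hr, hvr, hrv, hrr,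
    ?_⟩
  have hbox := h.wave_eq ![v, r, Real.pi / 2, 0] (by simpa using hv) (by simpa using hr)
    (by simpa using Real.pi_div_two_pos) (by simp [Real.pi_pos])
  rw [waveOp_symmField (by simpa using (hrp.trans hr).ne') (by simp)
    (hvr.congr_of_eventuallyEq (.of_forall fun s => (killingDeriv_eq_deriv hv).symm))
    (hrv.congr_of_eventuallyEq (.of_forall fun w => (radialDeriv_eq_deriv hr).symm))
    (hrr.congr_of_eventuallyEq ((lt_mem_nhds hr).mono fun s hs => (radialDeriv_eq_deriv hs).symm))]
    at hbox
  simp only [symmField, Matrix.cons_val_zero, Matrix.cons_val_one] at hbox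
  rw [← killingDeriv_eq_deriv hv, ← radialDeriv_eq_deriv hr] at hbox
  rw [← hbox]
  ring

end PartialDerivatives

section Rectangle

variable {F G H : ℝ → ℝ → ℝ} {v₁ v₂ r₁ r₂ : ℝ}

theorem continuousOn_fderivWithin_add_fderivWithin (hv : v₁ < v₂) (hr : r₁ < r₂)
    (hF : ContDiffOn ℝ 1 (fun p : ℝ × ℝ => F p.1 p.2) (Icc v₁ v₂ ×ˢ Icc r₁ r₂))
    (hG : ContDiffOn ℝ 1 (fun p : ℝ × ℝ => G p.1 p.2) (Icc v₁ v₂ ×ˢ Icc r₁ r₂)) :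
    ContinuousOn (fun p =>
      fderivWithin ℝ (fun p : ℝ × ℝ => F p.1 p.2) (Icc v₁ v₂ ×ˢ Icc r₁ r₂) p (1, 0) +
        fderivWithin ℝ (fun p : ℝ × ℝ => G p.1 p.2) (Icc v₁ v₂ ×ˢ Icc r₁ r₂) p (0, 1))
      (Icc v₁ v₂ ×ˢ Icc r₁ r₂) :=
  have hR := (uniqueDiffOn_Icc hv).prod (uniqueDiffOn_Icc hr)
  ((hF.continuousOn_fderivWithin hR le_rfl).clm_apply continuousOn_const).add
    ((hG.continuousOn_fderivWithin hR le_rfl).clm_apply continuousOn_const)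

theorem fderivWithin_add_fderivWithin_le (hv : v₁ < v₂) (hr : r₁ < r₂)
    (hF : ContDiffOn ℝ 1 (fun p : ℝ × ℝ => F p.1 p.2) (Icc v₁ v₂ ×ˢ Icc r₁ r₂))
    (hG : ContDiffOn ℝ 1 (fun p : ℝ × ℝ => G p.1 p.2) (Icc v₁ v₂ ×ˢ Icc r₁ r₂))
    (hH : ContinuousOn (fun p : ℝ × ℝ => H p.1 p.2) (Icc v₁ v₂ ×ˢ Icc r₁ r₂))
    (hdiv : ∀ v ∈ Ioo v₁ v₂, ∀ r ∈ Ioo r₁ r₂, ∃ F' G',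
      HasDerivAt (fun w => F w r) F' v ∧ HasDerivAt (G v) G' r ∧ F' + G' ≤ H v r)
    {p : ℝ × ℝ} (hp : p ∈ Icc v₁ v₂ ×ˢ Icc r₁ r₂) :
    fderivWithin ℝ (fun p : ℝ × ℝ => F p.1 p.2) (Icc v₁ v₂ ×ˢ Icc r₁ r₂) p (1, 0) +
      fderivWithin ℝ (fun p : ℝ × ℝ => G p.1 p.2) (Icc v₁ v₂ ×ˢ Icc r₁ r₂) p (0, 1) ≤
        H p.1 p.2 := by
  have hcl : closure (Ioo v₁ v₂ ×ˢ Ioo r₁ r₂) = Icc v₁ v₂ ×ˢ Icc r₁ r₂ := by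
    rw [closure_prod_eq, closure_Ioo hv.ne, closure_Ioo hr.ne]
  have hcont := continuousOn_fderivWithin_add_fderivWithin hv hr hF hG
  refine le_on_closure (s := Ioo v₁ v₂ ×ˢ Ioo r₁ r₂) (g := fun p => H p.1 p.2) (fun q hq => ?_)
    (by rwa [hcl]) (by rwa [hcl]) (by rwa [hcl])
  have hR : Icc v₁ v₂ ×ˢ Icc r₁ r₂ ∈ nhds q :=
    prod_mem_nhds (Icc_mem_nhds hq.1.1 hq.1.2) (Icc_mem_nhds hq.2.1 hq.2.2)
  obtain ⟨f', g', hf', hg', hle⟩ := hdiv q.1 hq.1 q.2 hq.2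
  rwa [fderivWithin_apply_fst (hF.differentiableOn one_ne_zero) hR hf',
    fderivWithin_apply_snd (hG.differentiableOn one_ne_zero) hR hg']

theorem integral_boundary_le_of_divergence_le (hv : v₁ < v₂) (hr : r₁ < r₂)
    (hF : ContDiffOn ℝ 1 (fun p : ℝ × ℝ => F p.1 p.2) (Icc v₁ v₂ ×ˢ Icc r₁ r₂))
    (hG : ContDiffOn ℝ 1 (fun p : ℝ × ℝ => G p.1 p.2) (Icc v₁ v₂ ×ˢ Icc r₁ r₂))
    (hH : ContinuousOn (fun p : ℝ × ℝ => H p.1 p.2) (Icc v₁ v₂ ×ˢ Icc r₁ r₂))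
    (hdiv : ∀ v ∈ Ioo v₁ v₂, ∀ r ∈ Ioo r₁ r₂, ∃ F' G',
      HasDerivAt (fun w => F w r) F' v ∧ HasDerivAt (G v) G' r ∧ F' + G' ≤ H v r) :
    (∫ r in r₁..r₂, F v₂ r) - (∫ r in r₁..r₂, F v₁ r) +
      ((∫ v in v₁..v₂, G v r₂) - ∫ v in v₁..v₂, G v r₁) ≤
        ∫ v in v₁..v₂, ∫ r in r₁..r₂, H v r := by
  set R := Icc v₁ v₂ ×ˢ Icc r₁ r₂
  have hbox : Icc (v₁, r₁) (v₂, r₂) = R := (Icc_prod_Icc v₁ v₂ r₁ r₂).symm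
  have hRc : IsCompact R := isCompact_Icc.prod isCompact_Icc
  have hRn {p : ℝ × ℝ} (hp : p ∈ Ioo v₁ v₂ ×ˢ Ioo r₁ r₂) : R ∈ nhds p :=
    prod_mem_nhds (Icc_mem_nhds hp.1.1 hp.1.2) (Icc_mem_nhds hp.2.1 hp.2.2)
  set F' := fderivWithin ℝ (fun p : ℝ × ℝ => F p.1 p.2) R
  set G' := fderivWithin ℝ (fun p : ℝ × ℝ => G p.1 p.2) R
  have hFd := hF.differentiableOn one_ne_zero
  have hGd := hG.differentiableOn one_ne_zero
  have hcont : ContinuousOn (fun p => F' p (1, 0) + G' p (0, 1)) R :=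
    continuousOn_fderivWithin_add_fderivWithin hv hr hF hG
  have hdivergence := integral_divergence_prod_Icc_of_hasFDerivAt_off_countable_of_le
    (fun p : ℝ × ℝ => F p.1 p.2) (fun p => G p.1 p.2) F' G' (v₁, r₁) (v₂, r₂) ⟨hv.le, hr.le⟩ ∅
    countable_empty (hbox ▸ hF.continuousOn) (hbox ▸ hG.continuousOn)
    (fun p hp => (hFd p (mem_of_mem_nhds (hRn hp.1))).hasFDerivWithinAt.hasFDerivAt (hRn hp.1))
    (fun p hp => (hGd p (mem_of_mem_nhds (hRn hp.1))).hasFDerivWithinAt.hasFDerivAt (hRn hp.1))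
    (hbox ▸ hcont.integrableOn_compact hRc)
  rw [hbox] at hdivergence
  calc _ = ∫ p in R, F' p (1, 0) + G' p (0, 1) := by rw [hdivergence]; dsimp only; ring
    _ ≤ ∫ p in R, H p.1 p.2 := setIntegral_mono_on (hcont.integrableOn_compact hRc)
        (hH.integrableOn_compact hRc) hRc.measurableSet
        fun _ hp => fderivWithin_add_fderivWithin_le hv hr hF hG hH hdiv hp
    _ = ∫ v in v₁..v₂, ∫ r in r₁..r₂, H v r := by
        rw [Measure.volume_eq_prod, setIntegral_prod _ (hH.integrableOn_compact hRc)]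
        simp only [integral_Icc_eq_integral_Ioc, intervalIntegral.integral_of_le hv.le,
          intervalIntegral.integral_of_le hr.le]

end Rectangle

section Averages

open Filter Topology

variable {f : ℝ → ℝ} {N : ℝ}

theorem abs_div_le_one_of_mem_Ioc (hrp : 0 ≤ rp) (hr : r ∈ Ioc rp N) : |r / N| ≤ 1 := by
  have hr0 : 0 ≤ r := hrp.trans hr.1.le
  rw [abs_of_nonneg (div_nonneg hr0 (hr0.trans hr.2))]
  exact div_le_one_of_le₀ hr.2 (hr0.trans hr.2)

theorem integrableOn_div_mul (hrp : 0 ≤ rp) (hf : IntegrableOn f (Ioi rp)) (N : ℝ) :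
    IntegrableOn (fun r => r / N * f r) (Ioc rp N) :=
  (hf.mono_set Ioc_subset_Ioi_self).bdd_mul (c := 1) (by fun_prop)
    (ae_restrict_of_forall_mem measurableSet_Ioc fun _ hr => abs_div_le_one_of_mem_Ioc hrp hr)

theorem integral_div_mul_nonneg (hrp : 0 ≤ rp) (hf0 : ∀ r ∈ Ioi rp, 0 ≤ f r) (hN : rp ≤ N) :
    0 ≤ ∫ r in rp..N, r / N * f r := by
  rw [intervalIntegral.integral_of_le hN]
  exact setIntegral_nonneg measurableSet_Ioc fun r hr =>
    mul_nonneg (div_nonneg (hrp.trans hr.1.le) (hrp.trans hN)) (hf0 r hr.1)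

theorem integral_div_mul_le (hrp : 0 ≤ rp) (hf : IntegrableOn f (Ioi rp))
    (hf0 : ∀ r ∈ Ioi rp, 0 ≤ f r) (hN : rp ≤ N) :
    ∫ r in rp..N, r / N * f r ≤ ∫ r in Ioi rp, f r := by
  rw [intervalIntegral.integral_of_le hN]
  calc ∫ r in Ioc rp N, r / N * f r ≤ ∫ r in Ioc rp N, f r :=
        setIntegral_mono_on (integrableOn_div_mul hrp hf N) (hf.mono_set Ioc_subset_Ioi_self)
          measurableSet_Ioc fun r hr => mul_le_of_le_one_left (hf0 r hr.1)
            ((le_abs_self _).trans (abs_div_le_one_of_mem_Ioc hrp hr))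
    _ ≤ ∫ r in Ioi rp, f r := setIntegral_mono_set hf
        (ae_restrict_of_forall_mem measurableSet_Ioi hf0) Ioc_subset_Ioi_self.eventuallyLE

theorem tendsto_integral_div_mul (hrp : 0 ≤ rp) (hf : IntegrableOn f (Ioi rp)) :
    Tendsto (fun N : ℝ => ∫ r in rp..N, r / N * f r) atTop (𝓝 0) := by
  have hlim : Tendsto (fun N : ℝ => ∫ r in Ioi rp, (Iic N).indicator (fun r => r / N * f r) r)
      atTop (𝓝 (∫ _ in Ioi rp, (0 : ℝ))) := by
    refine tendsto_integral_filter_of_dominated_convergence (fun r => ‖f r‖)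
      (.of_forall fun N => ?_) (.of_forall fun N => ?_) hf.norm (ae_of_all _ fun r => ?_)
    · exact ((by fun_prop : Continuous fun r : ℝ => r / N).aestronglyMeasurable.mul
        hf.aestronglyMeasurable).indicator measurableSet_Iic
    · refine ae_restrict_of_forall_mem measurableSet_Ioi fun r hr => ?_
      by_cases hrN : r ∈ Iic N
      · rw [indicator_of_mem hrN, norm_mul]
        exact mul_le_of_le_one_left (norm_nonneg _) (abs_div_le_one_of_mem_Ioc hrp ⟨hr, hrN⟩)
      · rw [indicator_of_notMem hrN, norm_zero]
        exact norm_nonneg _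
    · refine squeeze_zero_norm (fun N => norm_indicator_le_norm_self _ _) ?_
      simpa using ((tendsto_const_nhds (x := r)).div_atTop tendsto_id).mul_const (f r) |>.norm
  rw [integral_zero] at hlim
  refine hlim.congr' ((eventually_ge_atTop rp).mono fun N hN => ?_)
  simp only [setIntegral_indicator measurableSet_Iic, Ioi_inter_Iic,
    intervalIntegral.integral_of_le hN]

theorem tendsto_integral_cutoff_mul (hrp : 0 ≤ rp) (hf : IntegrableOn f (Ioi rp)) :
    Tendsto (fun N : ℝ => ∫ r in rp..N, (1 - r / N) * f r) atTop (𝓝 (∫ r in Ioi rp, f r)) := by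
  have hlim := (intervalIntegral_tendsto_integral_Ioi rp hf tendsto_id).sub
    (tendsto_integral_div_mul hrp hf)
  rw [sub_zero] at hlim
  refine hlim.congr' ((eventually_ge_atTop rp).mono fun N hN => ?_)
  simp only [id_eq, intervalIntegral.integral_of_le hN, sub_mul, one_mul]
  exact (integral_sub (hf.mono_set Ioc_subset_Ioi_self) (integrableOn_div_mul hrp hf N)).symm

theorem tendsto_integral_integral_div_mul {g : ℝ → ℝ → ℝ} {v₁ v₂ K : ℝ} (hrp : 0 ≤ rp)
    (hv : v₁ ≤ v₂) (hg : ContinuousOn (fun p : ℝ × ℝ => g p.1 p.2) (Icc v₁ v₂ ×ˢ Ici rp))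
    (hg0 : ∀ v ∈ Icc v₁ v₂, ∀ r ∈ Ioi rp, 0 ≤ g v r)
    (hgi : ∀ v ∈ Icc v₁ v₂, IntegrableOn (g v) (Ioi rp))
    (hK : ∀ v ∈ Icc v₁ v₂, ∫ r in Ioi rp, g v r ≤ K) :
    Tendsto (fun N : ℝ => ∫ v in v₁..v₂, ∫ r in rp..N, r / N * g v r) atTop (𝓝 0) := by
  have hmem {v : ℝ} (hvmem : v ∈ uIoc v₁ v₂) : v ∈ Icc v₁ v₂ :=
    Ioc_subset_Icc_self (uIoc_of_le hv ▸ hvmem)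
  rw [← intervalIntegral.integral_zero (a := v₁) (b := v₂) (μ := volume)]
  refine intervalIntegral.tendsto_integral_filter_of_dominated_convergence (fun _ => K)
    ((eventually_ge_atTop rp).mono fun N hN => ?_) ((eventually_ge_atTop rp).mono fun N hN => ?_)
    intervalIntegrable_const
    (ae_of_all _ fun v hv' => tendsto_integral_div_mul hrp (hgi v (hmem hv')))
  · have hmeas : AEStronglyMeasurable (fun p : ℝ × ℝ => p.2 / N * g p.1 p.2)
        ((volume.restrict (Ioc v₁ v₂)).prod (volume.restrict (Ioc rp N))) := by
      rw [Measure.prod_restrict]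
      exact ((by fun_prop : Continuous fun p : ℝ × ℝ => p.2 / N).continuousOn.mul (hg.mono
        (prod_mono Ioc_subset_Icc_self (Ioc_subset_Ioi_self.trans Ioi_subset_Ici_self)))
        ).aestronglyMeasurable (measurableSet_Ioc.prod measurableSet_Ioc)
    rw [uIoc_of_le hv]
    simpa only [intervalIntegral.integral_of_le hN] using hmeas.integral_prod_right'
  · refine ae_of_all _ fun v hv' => ?_
    rw [Real.norm_of_nonneg (integral_div_mul_nonneg hrp (hg0 v (hmem hv')) hN)]
    exact (integral_div_mul_le hrp (hgi v (hmem hv')) (hg0 v (hmem hv')) hN).trans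
      (hK v (hmem hv'))

end Averages

/-- The integrand of `flux`, extended continuously to the horizon. -/
def energyDensity (rp : ℝ) (Ψ : ℝ → ℝ → ℝ) (v r : ℝ) : ℝ :=
  fluxDensity r (radialDeriv rp Ψ v r) (Ψ v r)

/-- The density which controls the outflow of coercive currents through large spheres. Its integral
over the cones is finite by the boundary condition at infinity. -/
def outflowDensity (v0 rp : ℝ) (Ψ : ℝ → ℝ → ℝ) (v r : ℝ) : ℝ :=
  (r * killingDeriv v0 Ψ v r) ^ 2 + energyDensity rp Ψ v r

section Flux

variable {v0 v : ℝ} {Ψ : ℝ → ℝ → ℝ}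

theorem energyDensity_nonneg (rp : ℝ) (Ψ : ℝ → ℝ → ℝ) (v r : ℝ) : 0 ≤ energyDensity rp Ψ v r :=
  fluxDensity_nonneg ..

theorem outflowDensity_nonneg (v0 rp : ℝ) (Ψ : ℝ → ℝ → ℝ) (v r : ℝ) :
    0 ≤ outflowDensity v0 rp Ψ v r :=
  add_nonneg (sq_nonneg _) (energyDensity_nonneg ..)

theorem flux_eq_lintegral (rp : ℝ) (Ψ : ℝ → ℝ → ℝ) (v : ℝ) :
    flux rp Ψ v = ∫⁻ r in Ioi rp, ENNReal.ofReal (energyDensity rp Ψ v r) :=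
  setLIntegral_congr_fun measurableSet_Ioi fun r hr => by
    rw [energyDensity, fluxDensity, radialDeriv_eq_deriv hr]

theorem lintegral_sq_mul_le_flux (rp : ℝ) (Ψ : ℝ → ℝ → ℝ) (v : ℝ) :
    ∫⁻ r in Ioi rp, ENNReal.ofReal ((r * Ψ v r) ^ 2) ≤ flux rp Ψ v := by
  rw [flux_eq_lintegral]
  exact lintegral_mono fun r => ENNReal.ofReal_le_ofReal (sq_mul_le_fluxDensity ..)

theorem continuousOn_energyDensity
    (hΨ : ContDiffOn ℝ 2 (fun p : ℝ × ℝ => Ψ p.1 p.2) (Ici v0 ×ˢ Ici rp)) :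
    ContinuousOn (fun p : ℝ × ℝ => energyDensity rp Ψ p.1 p.2) (Ici v0 ×ˢ Ici rp) := by
  have hψ := hΨ.continuousOn
  have hψr := (contDiffOn_radialDeriv hΨ).continuousOn
  unfold energyDensity fluxDensity
  fun_prop

theorem continuousOn_outflowDensity
    (hΨ : ContDiffOn ℝ 2 (fun p : ℝ × ℝ => Ψ p.1 p.2) (Ici v0 ×ˢ Ici rp)) :
    ContinuousOn (fun p : ℝ × ℝ => outflowDensity v0 rp Ψ p.1 p.2) (Ici v0 ×ˢ Ici rp) :=
  ((continuousOn_snd.mul (contDiffOn_killingDeriv hΨ).continuousOn).pow 2).add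
    (continuousOn_energyDensity hΨ)

theorem integrable_and_integral_le_of_lintegral_le {α : Type*} [MeasurableSpace α]
    {μ : Measure α} {g : α → ℝ} (hg : AEStronglyMeasurable g μ) (hg0 : 0 ≤ᵐ[μ] g) {K : NNReal}
    (hK : ∫⁻ x, ENNReal.ofReal (g x) ∂μ ≤ K) : Integrable g μ ∧ ∫ x, g x ∂μ ≤ K := by
  refine ⟨⟨hg, ?_⟩, ?_⟩
  · rw [hasFiniteIntegral_iff_ofReal hg0]
    exact hK.trans_lt ENNReal.coe_lt_top
  · rw [integral_eq_lintegral_of_nonneg_ae hg0 hg]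
    exact ENNReal.toReal_le_coe_of_le_coe hK

theorem aestronglyMeasurable_slice {g : ℝ → ℝ → ℝ}
    (hg : ContinuousOn (fun p : ℝ × ℝ => g p.1 p.2) (Ici v0 ×ˢ Ici rp)) (hv : v0 ≤ v) :
    AEStronglyMeasurable (g v) (volume.restrict (Ioi rp)) :=
  (hg.comp (Continuous.prodMk_right v).continuousOn fun _ hr =>
    mk_mem_prod hv (Ioi_subset_Ici_self hr)).aestronglyMeasurable measurableSet_Ioi

namespace IsSolution

theorem integrableOn_energyDensity (h : IsSolution M l a rp v0 Ψ) (hv : v0 ≤ v) :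
    IntegrableOn (energyDensity rp Ψ v) (Ioi rp) := by
  obtain ⟨K, hK⟩ := h.flux_bounded v
  refine (integrable_and_integral_le_of_lintegral_le
    (aestronglyMeasurable_slice (continuousOn_energyDensity h.contDiffOn) hv)
    (ae_of_all _ (energyDensity_nonneg rp Ψ v)) (K := K) ?_).1
  exact (flux_eq_lintegral rp Ψ v).symm.trans_le (hK v ⟨hv, le_rfl⟩)

theorem flux_eq_integral (h : IsSolution M l a rp v0 Ψ) (hv : v0 ≤ v) :
    flux rp Ψ v = ENNReal.ofReal (∫ r in Ioi rp, energyDensity rp Ψ v r) := by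
  rw [flux_eq_lintegral, ofReal_integral_eq_lintegral_ofReal (h.integrableOn_energyDensity hv)
    (ae_of_all _ (energyDensity_nonneg rp Ψ v))]

theorem exists_integral_outflowDensity_le (h : IsSolution M l a rp v0 Ψ) (v₁ : ℝ) :
    ∃ K, ∀ v ∈ Icc v0 v₁, IntegrableOn (outflowDensity v0 rp Ψ v) (Ioi rp) ∧
      ∫ r in Ioi rp, outflowDensity v0 rp Ψ v r ≤ K := by
  obtain ⟨K, hK⟩ := h.flux_bounded v₁
  obtain ⟨K', hK'⟩ := h.flux_killingDeriv_bounded v₁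
  refine ⟨(K' + K : NNReal), fun v hv => integrable_and_integral_le_of_lintegral_le
    (aestronglyMeasurable_slice (continuousOn_outflowDensity h.contDiffOn) hv.1)
    (ae_of_all _ (outflowDensity_nonneg v0 rp Ψ v)) ?_⟩
  have hmeas :=
    (aestronglyMeasurable_slice (continuousOn_energyDensity h.contDiffOn) hv.1).aemeasurable
  calc ∫⁻ r in Ioi rp, ENNReal.ofReal (outflowDensity v0 rp Ψ v r)
      = (∫⁻ r in Ioi rp, ENNReal.ofReal ((r * killingDeriv v0 Ψ v r) ^ 2)) + flux rp Ψ v := by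
        rw [flux_eq_lintegral, ← lintegral_add_right' _ hmeas.ennreal_ofReal]
        simp only [outflowDensity, ENNReal.ofReal_add (sq_nonneg _) (energyDensity_nonneg ..)]
    _ ≤ K' + K := add_le_add ((lintegral_sq_mul_le_flux ..).trans (hK' v hv)) (hK v hv)
    _ = (K' + K : NNReal) := (ENNReal.coe_add ..).symm

end IsSolution

end Flux

section EnergyDecay

open Filter Topology

variable {v0 v₁ v N c₁ c₂ c₃ c₄ : ℝ} {Ψ : ℝ → ℝ → ℝ} {A : Current}

/-- The energy on the cone of constant `v` defined by a current. -/
def Current.energy (A : Current) (rp : ℝ) (Ψ : ℝ → ℝ → ℝ) (v : ℝ) : ℝ :=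
  ∫ r in Ioi rp, A.density r (radialDeriv rp Ψ v r) (Ψ v r)

namespace Current.IsConserved

theorem contDiffOn_density_field (hA : A.IsConserved M l a) (hrp : 0 < rp)
    (hΨ : ContDiffOn ℝ 2 (fun p : ℝ × ℝ => Ψ p.1 p.2) (Ici v0 ×ˢ Ici rp)) :
    ContDiffOn ℝ 1 (fun p : ℝ × ℝ => A.density p.2 (radialDeriv rp Ψ p.1 p.2) (Ψ p.1 p.2))
      (Ici v0 ×ˢ Ici rp) :=
  hA.contDiffOn_density.comp (contDiff_snd.contDiffOn.prodMk ((contDiffOn_radialDeriv hΨ).prodMk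
    (hΨ.of_le one_le_two))) fun _ hp => mk_mem_prod (hrp.trans_le hp.2) (mem_univ _)

theorem contDiffOn_outflow_field (hA : A.IsConserved M l a) (hrp : 0 < rp)
    (hΨ : ContDiffOn ℝ 2 (fun p : ℝ × ℝ => Ψ p.1 p.2) (Ici v0 ×ˢ Ici rp)) :
    ContDiffOn ℝ 1 (fun p : ℝ × ℝ => A.outflow p.2 (killingDeriv v0 Ψ p.1 p.2)
      (radialDeriv rp Ψ p.1 p.2) (Ψ p.1 p.2)) (Ici v0 ×ˢ Ici rp) :=
  hA.contDiffOn_outflow.comp (contDiff_snd.contDiffOn.prodMk ((contDiffOn_killingDeriv hΨ).prodMk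
    ((contDiffOn_radialDeriv hΨ).prodMk (hΨ.of_le one_le_two))))
      fun _ hp => mk_mem_prod (hrp.trans_le hp.2) (mem_univ _)

end Current.IsConserved

namespace IsSolution

theorem exists_weighted_divergence_le (h : IsSolution M l a rp v0 Ψ) (hrp : 0 < rp)
    (hA : A.IsConserved M l a) (hAc : A.IsCoercive rp c₁ c₂ c₃ c₄) (hv : v0 < v)
    (hr : r ∈ Ioo rp N) :
    ∃ F' G', HasDerivAt (fun w => (1 - r / N) *
          (Real.exp (c₄ * w) * A.density r (radialDeriv rp Ψ w r) (Ψ w r))) F' v ∧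
      HasDerivAt (fun s => (1 - s / N) * (Real.exp (c₄ * v) *
          A.outflow s (killingDeriv v0 Ψ v s) (radialDeriv rp Ψ v s) (Ψ v s))) G' r ∧
      F' + G' ≤ r / N * (Real.exp (c₄ * v) * (c₃ * outflowDensity v0 rp Ψ v r)) := by
  have hr0 : 0 < r := hrp.trans hr.1
  have hN0 : 0 < N := hr0.trans hr.2
  obtain ⟨e', J', he, hJ, hbalance⟩ := hA.balance hr0 (h.isWaveJet hrp hv hr.1)
  have hexp : HasDerivAt (fun w => Real.exp (c₄ * w)) (Real.exp (c₄ * v) * c₄) v := by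
    simpa using ((hasDerivAt_id v).const_mul c₄).exp
  have hcut : HasDerivAt (fun s : ℝ => 1 - s / N) (-(1 / N)) r :=
    ((hasDerivAt_id r).div_const N).const_sub 1
  refine ⟨_, _, (hexp.fun_mul he).const_mul (1 - r / N),
    hcut.fun_mul (hJ.const_mul (Real.exp (c₄ * v))), ?_⟩
  set d := killingDeriv v0 Ψ v r
  set p := radialDeriv rp Ψ v r
  set q := Ψ v r
  have hcut0 : 0 ≤ 1 - r / N := sub_nonneg.2 ((div_le_one hN0).2 hr.2.le)
  have hbulk := hAc.density_le_bulk hr.1.le d p q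
  have hout := hAc.neg_outflow_le hr.1.le d p q
  calc _ = Real.exp (c₄ * v) * ((1 - r / N) * (c₄ * A.density r p q - A.bulk r d p q) +
          1 / N * -A.outflow r d p q) := by
        linear_combination (1 - r / N) * Real.exp (c₄ * v) * hbalance
    _ ≤ Real.exp (c₄ * v) * (0 + 1 / N * (c₃ * (r * ((r * d) ^ 2 + fluxDensity r p q)))) := by
        gcongr
        exact mul_nonpos_of_nonneg_of_nonpos hcut0 (sub_nonpos.2 hbulk)
    _ = _ := by
        rw [outflowDensity, energyDensity]
        ring

theorem cutoff_energy_le (h : IsSolution M l a rp v0 Ψ) (hrp : 0 < rp)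
    (hA : A.IsConserved M l a) (hAc : A.IsCoercive rp c₁ c₂ c₃ c₄) (hv : v0 < v) (hN : rp < N) :
    (∫ r in rp..N, (1 - r / N) *
        (Real.exp (c₄ * v) * A.density r (radialDeriv rp Ψ v r) (Ψ v r))) -
      ∫ r in rp..N, (1 - r / N) *
        (Real.exp (c₄ * v0) * A.density r (radialDeriv rp Ψ v0 r) (Ψ v0 r)) ≤
    ∫ w in v0..v, ∫ r in rp..N, r / N *
      (Real.exp (c₄ * w) * (c₃ * outflowDensity v0 rp Ψ w r)) := by
  have hN0 : 0 < N := hrp.trans hN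
  have hsub : Icc v0 v ×ˢ Icc rp N ⊆ Ici v0 ×ˢ Ici rp :=
    prod_mono Icc_subset_Ici_self Icc_subset_Ici_self
  have hcut : ContDiff ℝ 1 fun p : ℝ × ℝ => 1 - p.2 / N := by fun_prop
  have hexp : ContDiff ℝ 1 fun p : ℝ × ℝ => Real.exp (c₄ * p.1) := by fun_prop
  have hdensity := (hA.contDiffOn_density_field hrp h.contDiffOn).mono hsub
  have houtflow := (hA.contDiffOn_outflow_field hrp h.contDiffOn).mono hsub
  have herror := (continuousOn_outflowDensity h.contDiffOn).mono hsub
  have hrect := integral_boundary_le_of_divergence_le hv hN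
    (hcut.contDiffOn.mul (hexp.contDiffOn.mul hdensity))
    (hcut.contDiffOn.mul (hexp.contDiffOn.mul houtflow))
    (H := fun w r => r / N * (Real.exp (c₄ * w) * (c₃ * outflowDensity v0 rp Ψ w r)))
    (by fun_prop)
    fun w hw r hr => h.exists_weighted_divergence_le hrp hA hAc hw.1 hr
  have hinfinity : ∫ w in v0..v, (1 - N / N) * (Real.exp (c₄ * w) *
      A.outflow N (killingDeriv v0 Ψ w N) (radialDeriv rp Ψ w N) (Ψ w N)) = 0 := by
    simp [div_self hN0.ne']
  have hhorizon : ∫ w in v0..v, (1 - rp / N) * (Real.exp (c₄ * w) *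
      A.outflow rp (killingDeriv v0 Ψ w rp) (radialDeriv rp Ψ w rp) (Ψ w rp)) ≤ 0 := by
    rw [intervalIntegral.integral_of_le hv.le]
    exact integral_nonpos fun w => mul_nonpos_of_nonneg_of_nonpos
      (sub_nonneg.2 ((div_le_one hN0).2 hN.le))
      (mul_nonpos_of_nonneg_of_nonpos (Real.exp_pos _).le (hAc.outflow_horizon ..))
  rw [hinfinity] at hrect
  linarith

theorem integrableOn_density (h : IsSolution M l a rp v0 Ψ) (hrp : 0 < rp)
    (hA : A.IsConserved M l a) (hAc : A.IsCoercive rp c₁ c₂ c₃ c₄) (hc₁ : 0 ≤ c₁) (hv : v0 ≤ v) :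
    IntegrableOn (fun r => A.density r (radialDeriv rp Ψ v r) (Ψ v r)) (Ioi rp) := by
  refine ((h.integrableOn_energyDensity hv).const_mul c₂).mono'
    (aestronglyMeasurable_slice (g := fun v r => A.density r (radialDeriv rp Ψ v r) (Ψ v r))
      (hA.contDiffOn_density_field hrp h.contDiffOn).continuousOn hv)
    (ae_restrict_of_forall_mem measurableSet_Ioi fun r hr => ?_)
  have hdensity : 0 ≤ A.density r (radialDeriv rp Ψ v r) (Ψ v r) :=
    (mul_nonneg hc₁ (fluxDensity_nonneg ..)).trans (hAc.le_density (le_of_lt hr) _ _)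
  rw [Real.norm_of_nonneg hdensity]
  exact hAc.density_le (le_of_lt hr) _ _

theorem exp_mul_energy_le (h : IsSolution M l a rp v0 Ψ) (hrp : 0 < rp)
    (hA : A.IsConserved M l a) (hAc : A.IsCoercive rp c₁ c₂ c₃ c₄) (hc₁ : 0 ≤ c₁) (hc₃ : 0 ≤ c₃)
    (hc₄ : 0 ≤ c₄) (hv : v0 ≤ v) :
    Real.exp (c₄ * v) * A.energy rp Ψ v ≤ Real.exp (c₄ * v0) * A.energy rp Ψ v0 := by
  obtain rfl | hv' := hv.eq_or_lt
  · exact le_rfl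
  obtain ⟨K, hK⟩ := h.exists_integral_outflowDensity_le v
  have herror : Tendsto (fun N => ∫ w in v0..v, ∫ r in rp..N, r / N *
      (Real.exp (c₄ * w) * (c₃ * outflowDensity v0 rp Ψ w r))) atTop (𝓝 0) := by
    refine tendsto_integral_integral_div_mul (K := Real.exp (c₄ * v) * (c₃ * K)) hrp.le hv ?_
      (fun w _ r _ => ?_) (fun w hw => ((hK w hw).1.const_mul c₃).const_mul _) fun w hw => ?_
    · have := (continuousOn_outflowDensity h.contDiffOn).mono
        (prod_mono (Icc_subset_Ici_self : Icc v0 v ⊆ Ici v0) Subset.rfl)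
      fun_prop
    · have := outflowDensity_nonneg v0 rp Ψ w r
      positivity
    · have : 0 ≤ ∫ r in Ioi rp, outflowDensity v0 rp Ψ w r :=
        setIntegral_nonneg measurableSet_Ioi fun r _ => outflowDensity_nonneg v0 rp Ψ w r
      rw [integral_const_mul, integral_const_mul]
      gcongr
      exacts [hw.2, (hK w hw).2]
  have henergy {w : ℝ} (hw : v0 ≤ w) := tendsto_integral_cutoff_mul hrp.le
    ((h.integrableOn_density hrp hA hAc hc₁ hw).const_mul (Real.exp (c₄ * w)))
  have hlim := le_of_tendsto_of_tendsto ((henergy hv).sub (henergy le_rfl)) herror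
    ((eventually_gt_atTop rp).mono fun N hN => h.cutoff_energy_le hrp hA hAc hv' hN)
  simpa only [Current.energy, integral_const_mul, sub_nonpos] using hlim

theorem integral_energyDensity_le (h : IsSolution M l a rp v0 Ψ) (hrp : 0 < rp)
    (hA : A.IsConserved M l a) (hAc : A.IsCoercive rp c₁ c₂ c₃ c₄) (hc₁ : 0 < c₁) (hc₃ : 0 ≤ c₃)
    (hc₄ : 0 ≤ c₄) (hv : v0 ≤ v) :
    ∫ r in Ioi rp, energyDensity rp Ψ v r ≤
      c₂ / c₁ * Real.exp (-c₄ * (v - v0)) * ∫ r in Ioi rp, energyDensity rp Ψ v0 r := by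
  have hlower : c₁ * ∫ r in Ioi rp, energyDensity rp Ψ v r ≤ A.energy rp Ψ v := by
    rw [← integral_const_mul]
    exact setIntegral_mono_on ((h.integrableOn_energyDensity hv).const_mul c₁)
      (h.integrableOn_density hrp hA hAc hc₁.le hv) measurableSet_Ioi
      fun r hr => hAc.le_density (le_of_lt hr) _ _
  have hupper : A.energy rp Ψ v0 ≤ c₂ * ∫ r in Ioi rp, energyDensity rp Ψ v0 r := by
    rw [← integral_const_mul]
    exact setIntegral_mono_on (h.integrableOn_density hrp hA hAc hc₁.le le_rfl)
      ((h.integrableOn_energyDensity le_rfl).const_mul c₂) measurableSet_Ioi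
      fun r hr => hAc.density_le (le_of_lt hr) _ _
  have hexp : Real.exp (c₄ * v0) = Real.exp (c₄ * v) * Real.exp (-c₄ * (v - v0)) := by
    rw [← Real.exp_add]
    ring_nf
  have hdecay := h.exp_mul_energy_le hrp hA hAc hc₁.le hc₃ hc₄ hv
  rw [hexp, mul_assoc, mul_le_mul_iff_right₀ (Real.exp_pos _)] at hdecay
  rw [div_mul_eq_mul_div, div_mul_eq_mul_div, le_div_iff₀' hc₁]
  calc _ ≤ _ := hlower
    _ ≤ _ := hdecay
    _ ≤ Real.exp (-c₄ * (v - v0)) * (c₂ * ∫ r in Ioi rp, energyDensity rp Ψ v0 r) := by gcongr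
    _ = _ := by ring

end IsSolution

end EnergyDecay

section Pointwise

theorem neg_two_mul_fluxDensity_le {r s p q : ℝ} (hr : 0 < r) (hs : s ∈ Icc r (2 * r)) :
    -2 * fluxDensity s p q ≤
      -(1 / r) * (s ^ 3 * q ^ 2) + (2 - s / r) * (3 * s ^ 2 * q ^ 2 + s ^ 3 * (2 * q * p)) := by
  have hone : 1 ≤ s / r := (one_le_div hr).2 hs.1
  have htwo : s / r ≤ 2 := (div_le_iff₀ hr).2 hs.2
  calc -2 * fluxDensity s p q
      ≤ -(s / r) * (s * q) ^ 2 + (2 - s / r) * (2 * (s * q) ^ 2 - (s ^ 2 * p) ^ 2) := by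
        unfold fluxDensity
        nlinarith [mul_nonneg (sub_nonneg.2 htwo) (sq_nonneg (s * q)),
          mul_nonneg (sub_nonneg.2 hone) (sq_nonneg (s ^ 2 * p)), sq_nonneg (s ^ 2 * p)]
    _ ≤ -(s / r) * (s * q) ^ 2 +
          (2 - s / r) * (3 * s ^ 2 * q ^ 2 + s ^ 3 * (2 * q * p)) := by
        have : 0 ≤ 2 - s / r := sub_nonneg.2 htwo
        gcongr
        linarith [sq_nonneg (s * q + s ^ 2 * p)]
    _ = _ := by ring

theorem cube_mul_sq_le {ψ ψr : ℝ → ℝ} (hrp : 0 < rp) (hr : rp ≤ r) (hψ : ContinuousOn ψ (Ici rp))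
    (hψr : ContinuousOn ψr (Ici rp)) (hderiv : ∀ s ∈ Ioi rp, HasDerivAt ψ (ψr s) s)
    (hint : IntegrableOn (fun s => fluxDensity s (ψr s) (ψ s)) (Ioi rp)) :
    r ^ 3 * ψ r ^ 2 ≤ 2 * ∫ s in Ioi rp, fluxDensity s (ψr s) (ψ s) := by
  have hr0 : 0 < r := hrp.trans_le hr
  have hle2 : r ≤ 2 * r := by linarith
  have hsub : Icc r (2 * r) ⊆ Ici rp := Icc_subset_Ici_self.trans (Ici_subset_Ici.2 hr)
  have hψ' := hψ.mono hsub
  have hψr' := hψr.mono hsub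
  have hflux : ContinuousOn (fun s => fluxDensity s (ψr s) (ψ s)) (Icc r (2 * r)) := by
    unfold fluxDensity
    fun_prop
  have hftc : ∫ s in r..2 * r, -2 * fluxDensity s (ψr s) (ψ s) ≤
      (2 - 2 * r / r) * ((2 * r) ^ 3 * ψ (2 * r) ^ 2) - (2 - r / r) * (r ^ 3 * ψ r ^ 2) := by
    refine intervalIntegral.integral_le_sub_of_hasDeriv_right_of_le
      (g := fun s => (2 - s / r) * (s ^ 3 * ψ s ^ 2)) hle2 (by fun_prop) (fun s hs => ?_)
      (hflux.const_mul (-2)).integrableOn_Icc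
      fun s hs => neg_two_mul_fluxDensity_le hr0 (Ioo_subset_Icc_self hs)
    have hcut : HasDerivAt (fun s : ℝ => 2 - s / r) (-(1 / r)) s :=
      ((hasDerivAt_id s).div_const r).const_sub 2
    have hsq := (hderiv s (hr.trans_lt hs.1)).fun_pow 2
    exact ((hcut.fun_mul ((hasDerivAt_pow 3 s).fun_mul hsq)).congr_deriv
      (by simp)).hasDerivWithinAt
  have hmono : ∫ s in r..2 * r, fluxDensity s (ψr s) (ψ s) ≤
      ∫ s in Ioi rp, fluxDensity s (ψr s) (ψ s) := by
    rw [intervalIntegral.integral_of_le hle2]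
    exact setIntegral_mono_set hint (ae_of_all _ fun s => fluxDensity_nonneg ..)
      (LE.le.eventuallyLE fun s hs => hr.trans_lt hs.1)
  rw [intervalIntegral.integral_const_mul, div_self hr0.ne', mul_div_cancel_right₀ _ hr0.ne',
    sub_self, zero_mul] at hftc
  linarith

end Pointwise

section Decay

variable {v0 v c₁ c₂ c₃ c₄ : ℝ} {Ψ : ℝ → ℝ → ℝ} {A : Current}

namespace IsSolution

theorem toReal_flux (h : IsSolution M l a rp v0 Ψ) (hv : v0 ≤ v) :
    (flux rp Ψ v).toReal = ∫ r in Ioi rp, energyDensity rp Ψ v r := by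
  rw [h.flux_eq_integral hv, ENNReal.toReal_ofReal]
  exact setIntegral_nonneg measurableSet_Ioi fun r _ => energyDensity_nonneg rp Ψ v r

theorem flux_le (h : IsSolution M l a rp v0 Ψ) (hrp : 0 < rp) (hA : A.IsConserved M l a)
    (hAc : A.IsCoercive rp c₁ c₂ c₃ c₄) (hc₁ : 0 < c₁) (hc₂ : 0 ≤ c₂) (hc₃ : 0 ≤ c₃)
    (hc₄ : 0 ≤ c₄) (hv : v0 ≤ v) :
    flux rp Ψ v ≤ ENNReal.ofReal (c₂ / c₁ * Real.exp (-c₄ * (v - v0))) * flux rp Ψ v0 := by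
  rw [h.flux_eq_integral hv, h.flux_eq_integral le_rfl, ← ENNReal.ofReal_mul (by positivity)]
  exact ENNReal.ofReal_le_ofReal (h.integral_energyDensity_le hrp hA hAc hc₁ hc₃ hc₄ hv)

theorem cube_mul_sq_le_toReal_flux (h : IsSolution M l a rp v0 Ψ) (hrp : 0 < rp) (hv : v0 ≤ v)
    (hr : rp ≤ r) : r ^ 3 * Ψ v r ^ 2 ≤ 2 * (flux rp Ψ v).toReal := by
  have hslice : MapsTo (Prod.mk v) (Ici rp) (Ici v0 ×ˢ Ici rp) := fun _ hs => mk_mem_prod hv hs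
  have hcont : ContinuousOn (Prod.mk v) (Ici rp) := (Continuous.prodMk_right v).continuousOn
  rw [h.toReal_flux hv]
  exact cube_mul_sq_le hrp hr (h.contDiffOn.continuousOn.comp hcont hslice)
    ((contDiffOn_radialDeriv h.contDiffOn).continuousOn.comp hcont hslice)
    (fun s hs => hasDerivAt_radialDeriv (h.contDiffOn.differentiableOn two_ne_zero) hv hs)
    (h.integrableOn_energyDensity hv)

theorem abs_le (h : IsSolution M l a rp v0 Ψ) (hrp : 0 < rp) (hA : A.IsConserved M l a)
    (hAc : A.IsCoercive rp c₁ c₂ c₃ c₄) (hc₁ : 0 < c₁) (hc₂ : 0 ≤ c₂) (hc₃ : 0 ≤ c₃)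
    (hc₄ : 0 ≤ c₄) (hv : v0 ≤ v) (hr : rp ≤ r) :
    |Ψ v r| ≤ √(2 * (c₂ / c₁)) * Real.exp (-(c₄ / 2) * (v - v0)) * √(flux rp Ψ v0).toReal /
      r ^ (3 / 2 : ℝ) := by
  have hr0 : 0 < r := hrp.trans_le hr
  have hpow : (r ^ (3 / 2 : ℝ)) ^ 2 = r ^ 3 := by
    rw [← Real.rpow_mul_natCast hr0.le]
    norm_num
  have hexp : Real.exp (-(c₄ / 2) * (v - v0)) ^ 2 = Real.exp (-c₄ * (v - v0)) := by
    rw [← Real.exp_nat_mul]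
    ring_nf
  have hdecay := h.integral_energyDensity_le hrp hA hAc hc₁ hc₃ hc₄ hv
  rw [← h.toReal_flux hv, ← h.toReal_flux le_rfl] at hdecay
  rw [le_div_iff₀ (by positivity)]
  refine le_of_sq_le_sq ?_ (by positivity)
  calc (|Ψ v r| * r ^ (3 / 2 : ℝ)) ^ 2 = r ^ 3 * Ψ v r ^ 2 := by
        rw [mul_pow, sq_abs, hpow, mul_comm]
    _ ≤ 2 * (flux rp Ψ v).toReal := h.cube_mul_sq_le_toReal_flux hrp hv hr
    _ ≤ 2 * (c₂ / c₁ * Real.exp (-c₄ * (v - v0)) * (flux rp Ψ v0).toReal) := by gcongr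
    _ = _ := by
        rw [mul_pow, mul_pow, Real.sq_sqrt (by positivity), hexp,
          Real.sq_sqrt ENNReal.toReal_nonneg]
        ring

end IsSolution

end Decay

end SchwarzschildAdS

end

theorem corollary3p1 (M l a rp : ℝ) (hM : 0 < M) (hl : 0 < l) (ha : -1 ≤ a)
    (hrp : 0 < rp) (hhor : SchwarzschildAdS.lapse M l rp = 0) :
    ∃ B c : ℝ, 0 < B ∧ 0 < c ∧
      ∀ (v0 : ℝ) (Ψ : ℝ → ℝ → ℝ), SchwarzschildAdS.IsSolution M l a rp v0 Ψ →
        (∀ v : ℝ, v0 ≤ v →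
          SchwarzschildAdS.flux rp Ψ v ≤
            ENNReal.ofReal (B * Real.exp (-c * (v - v0))) * SchwarzschildAdS.flux rp Ψ v0) ∧
        (∀ v r : ℝ, v0 ≤ v → rp ≤ r →
          |Ψ v r| ≤ B * Real.exp (-c * (v - v0)) *
            Real.sqrt (SchwarzschildAdS.flux rp Ψ v0).toReal / r ^ (3 / 2 : ℝ)) := by
  obtain ⟨A, c₁, c₂, c₃, c₄, hc₁, hc₂, hc₃, hc₄, hA, hAc⟩ :=
    SchwarzschildAdS.exists_isConserved_isCoercive hM.le hl ha hrp hhor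
  refine ⟨max (c₂ / c₁) √(2 * (c₂ / c₁)), c₄ / 2, lt_max_of_lt_left (div_pos hc₂ hc₁),
    half_pos hc₄, fun v0 Ψ h => ⟨fun v hv => ?_, fun v r hv hr => ?_⟩⟩
  · refine (h.flux_le hrp hA hAc hc₁ hc₂.le hc₃.le hc₄.le hv).trans ?_
    have : 0 ≤ v - v0 := sub_nonneg.2 hv
    gcongr
    · exact le_max_left ..
    · exact half_le_self hc₄.le
  · have hr0 : 0 < r := hrp.trans_le hr
    refine (h.abs_le hrp hA hAc hc₁ hc₂.le hc₃.le hc₄.le hv hr).trans ?_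
    gcongr
    exact le_max_right ..
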